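/- Let $p$ be a prime, let $dy$ be the Haar measure on $\mathbb{Q}_p$ with $\int_{\mathbb{Z}_p}dy=1$, let $$D^2f(x)=\frac{p^2-1}{1-p^{-3}}\int_{\mathbb{Q}_p}\frac{f(x)-f(y)}{|x-y|_p^{3}}\,dy ,\qquad \Gamma_p(s)=\frac{1-p^{s-1}}{1-p^{-s}}\quad(s\neq 0),$$ and take $B=1$. For a real number $E$, consider real sequences $(c_n)_{n\ge 0}$ and $(k_n)_{n\ge 1}$ with $$c_{2n+1}=0,\qquad c_2=0,\qquad c_{2n+4}\frac{\Gamma_p(2n+5)}{\Gamma_p(2n+3)}+Bc_{2n}=Ec_{2n+2}\qquad(n\ge 0),$$ $$k_{2n}=0,\qquad k_1=k_3=0,\qquad k_{2n+1}\frac{\Gamma_p(-2n)}{\Gamma_p(-2n-2)}+Bk_{2n+5}=Ek_{2n+3}\qquad(n\ge 1),$$ so that only $c_0$ and $k_5$ are free, and put $$\psi_0(x)=\begin{cases}\sum_{n\ge 0}c_n|x|_p^n, & x\in\mathbb{Z}_p,\\ \sum_{n\ge 1}k_n|x|_p^{-n}, & x\in\mathbb{Q}_p\setminus\mathbb{Z}_p.\end{cases}$$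 The energy conditions are the two linear equations in $(c_0,k_5)$ $$\sum_{n\ge 0}\frac{c_n}{\Gamma_p(-2)}\,\frac{p-1}{p-p^{3-n}}+\sum_{n\ge 1}\frac{k_n}{\Gamma_p(-2)}\,\frac{1-p}{p-p^{n+3}}=Ec_0,$$ $$-\sum_{n\ge 1}\frac{k_n}{\Gamma_p(-2)}\,\frac{p-1}{p-p^{n}}+\sum_{n\ge 0}\frac{c_n}{\Gamma_p(-2)}\,\frac{p-1}{p-p^{-n}}=-Bk_5,$$ where the terms with the coefficients $c_2=0$ and $k_1=0$ are omitted if their denominator vanishes. Then: 1. If $p$ is large relative to $E$, namely $|E|+1<p^2$, the series defining $\psi_0$ converge absolutely at every point of $\mathbb{Q}_p$, for all $c_0,k_5$. 2. There is a real number $E$ for which the energy conditions have a solution $(c_0,k_5)\neq(0,0)$. 3. For every real $E$ and all such sequences that satisfy the energy conditions, the series defining $\psi_0$ converge absolutely at every point of $\mathbb{Q}_p$, the integral defining $D^2\psi_0(x)$ converges absolutely for every $x\in\mathbb{Q}_p$, and $$D^2\psi_0(x)+B|x|_p^2\,\psi_0(x)=E\,\psi_0(x)\qquad\text{for all }x\in\mathbb{Q}_p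 .$$ -/

import Mathlib

open MeasureTheory

namespace PAdicSchrodinger

noncomputable section

/-- The Borel σ-algebra on `ℚ_p`. -/
instance instMeasurableSpacePadic (p : ℕ) [Fact p.Prime] : MeasurableSpace ℚ_[p] :=
  borel ℚ_[p]

instance instBorelSpacePadic (p : ℕ) [Fact p.Prime] : BorelSpace ℚ_[p] := ⟨rfl⟩

/-- The closed unit ball `ℤ_p = {x ∈ ℚ_p : |x|_p ≤ 1}`, a compact set with non-empty interior. -/
def unitBall (p : ℕ) [Fact p.Prime] : TopologicalSpace.PositiveCompacts ℚ_[p] where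
  carrier := Metric.closedBall 0 1
  isCompact' := isCompact_closedBall 0 1
  interior_nonempty' :=
    ⟨0, interior_mono Metric.ball_subset_closedBall
      (by rw [Metric.isOpen_ball.interior_eq]; exact Metric.mem_ball_self one_pos)⟩

/-- The Haar measure `dx` of `(ℚ_p, +)`, normalised by `∫_{ℤ_p} dx = 1`. -/
def haar (p : ℕ) [Fact p.Prime] : Measure ℚ_[p] :=
  Measure.addHaarMeasure (unitBall p)

/-- The `p`-adic Gamma function `Γ_p(s) = (1 - p^{s-1}) / (1 - p^{-s})`, `s ≠ 0`. -/
def Gam (p : ℕ) (s : ℝ) : ℝ :=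
  (1 - (p : ℝ) ^ (s - 1)) / (1 - (p : ℝ) ^ (-s))

/-- The integrand `y ↦ (f(x) - f(y)) / |x - y|_p^{α+1}` of the `p`-adic derivative at `x`. -/
def derivIntegrand (p : ℕ) [Fact p.Prime] (α : ℝ) (f : ℚ_[p] → ℂ) (x y : ℚ_[p]) : ℂ :=
  (f x - f y) / ((‖x - y‖ ^ (α + 1) : ℝ) : ℂ)

/-- The `p`-adic derivative
`D^α f(x) = (p^α - 1) / (1 - p^{-α-1}) ∫_{ℚ_p} (f(x) - f(y)) / |x - y|_p^{α+1} dy`. -/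
def D (p : ℕ) [Fact p.Prime] (α : ℝ) (f : ℚ_[p] → ℂ) (x : ℚ_[p]) : ℂ :=
  ((((p : ℝ) ^ α - 1) / (1 - (p : ℝ) ^ (-α - 1)) : ℝ) : ℂ) *
    ∫ y, derivIntegrand p α f x y ∂(haar p)

/-- `f` solves `D² f + B |x|_p² f = E f`: at every point of `ℚ_p` the integral defining `D² f`
converges absolutely and the equation holds. -/
def IsSolution (p : ℕ) [Fact p.Prime] (B E : ℝ) (f : ℚ_[p] → ℂ) : Prop :=
  ∀ x : ℚ_[p],
    Integrable (derivIntegrand p 2 f x) (haar p) ∧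
      D p 2 f x + (B : ℂ) * ((‖x‖ ^ 2 : ℝ) : ℂ) * f x = (E : ℂ) * f x

/-- The recursions for the coefficients `c_n` (`n ≥ 0`) and `k_n` (`n ≥ 1`), with the initial values
that leave exactly `c_0` and `k_5` free. The value `k 0` is not used. -/
structure IsCoeff (p : ℕ) (B E : ℝ) (c k : ℕ → ℝ) : Prop where
  c_odd : ∀ n : ℕ, c (2 * n + 1) = 0
  c_two : c 2 = 0
  c_rec : ∀ n : ℕ,
    c (2 * n + 4) * (Gam p (2 * n + 5) / Gam p (2 * n + 3)) + B * c (2 * n) = E * c (2 * n + 2)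
  k_even : ∀ n : ℕ, 1 ≤ n → k (2 * n) = 0
  k_one : k 1 = 0
  k_three : k 3 = 0
  k_rec : ∀ n : ℕ, 1 ≤ n →
    k (2 * n + 1) * (Gam p (-2 * n) / Gam p (-2 * n - 2)) + B * k (2 * n + 5)
      = E * k (2 * n + 3)

/-- The two remaining conditions, from the coefficient of `|x|_p^0` on `ℤ_p` and that of
`|x|_p^{-3}` off `ℤ_p`. They are linear in `(c_0, k_5)`, and `E` is determined by `B` through the
requirement that they have a solution `(c_0, k_5) ≠ (0, 0)`.
The terms with a vanishing denominator (`n = 2` in the first sum, `n = 1` in the third) have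
coefficient `c_2 = 0`, `k_1 = 0`. Convergence of the four series is not part of the conditions. -/
structure EnergyCondition (p : ℕ) (B E : ℝ) (c k : ℕ → ℝ) : Prop where
  inner :
    (∑' n : ℕ, c n * (1 / Gam p (-2)) * (((p : ℝ) - 1) / ((p : ℝ) - (p : ℝ) ^ (3 - (n : ℤ)))))
      + (∑' n : ℕ, k (n + 1) * (1 / Gam p (-2)) *
          ((1 - (p : ℝ)) / ((p : ℝ) - (p : ℝ) ^ ((n + 1) + 3))))
      = E * c 0
  outer :
    -(∑' n : ℕ, k (n + 1) * (1 / Gam p (-2)) *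
          (((p : ℝ) - 1) / ((p : ℝ) - (p : ℝ) ^ (n + 1))))
      + (∑' n : ℕ, c n * (1 / Gam p (-2)) * (((p : ℝ) - 1) / ((p : ℝ) - (p : ℝ) ^ (-(n : ℤ)))))
      = -B * k 5

/-- The series `∑_{n ≥ 0} c_n |x|_p^n` on `ℤ_p` and `∑_{n ≥ 1} k_n |x|_p^{-n}` off `ℤ_p` converge
(absolutely) at every point of `ℚ_p`. -/
def ConvergesEverywhere (p : ℕ) [Fact p.Prime] (c k : ℕ → ℝ) : Prop :=
  (∀ x : ℚ_[p], ‖x‖ ≤ 1 → Summable fun n : ℕ => c n * ‖x‖ ^ n) ∧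
    (∀ x : ℚ_[p], ¬ ‖x‖ ≤ 1 → Summable fun n : ℕ => k (n + 1) * (‖x‖ ^ (n + 1))⁻¹)

open Classical in
/-- `ψ_0(x) = ∑_{n ≥ 0} c_n |x|_p^n` on `ℤ_p` and `ψ_0(x) = ∑_{n ≥ 1} k_n |x|_p^{-n}` off `ℤ_p`. -/
def psi (p : ℕ) [Fact p.Prime] (c k : ℕ → ℝ) (x : ℚ_[p]) : ℂ :=
  if ‖x‖ ≤ 1 then ((∑' n : ℕ, c n * ‖x‖ ^ n : ℝ) : ℂ)
  else ((∑' n : ℕ, k (n + 1) * (‖x‖ ^ (n + 1))⁻¹ : ℝ) : ℂ)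

end

end PAdicSchrodinger

/-! Everything is radial. Put `r = 1/p`. Where `|x| ≠ |y|` one has `|x - y| = max |x| |y|`, and
where `|x| = |y|` the numerator `ψ_0(x) - ψ_0(y)` vanishes, so the integral for `D²ψ_0(x)` is a sum
over the spheres `|y| = p^i` (`radial_integral`, `sphereTerm`). Exchanging this sum with the power
series (`hasSum_tsum_mul`) leaves geometric series in each coefficient. For `x` in the unit ball, a
power `|x|^(2m)` that occurs returns its Gamma ratio times `|x|^(2m-2)` plus a constant. Off the
ball, `|x|^(-(2m+5))` returns a Gamma ratio times `|x|^(-(2m+7))` plus a multiple of `|x|^(-3)`. The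
recursions match the first kind of term with `(E - |x|²) ψ_0`. The extra terms come from cutting at
`|x| = 1` and from the complementary region, and they cancel exactly under the two energy conditions
(`hasSum_sphereTerm_inner`, `hasSum_sphereTerm_zero`, `hasSum_sphereTerm_outer`).

Convergence: after rescaling the `k`'s by `p^(-2m)`, both recursions tend geometrically fast to the
one with characteristic polynomial `z² - (E/p²) z + 1/p²`. Its roots lie in the open unit disc when
`|E| < p² + 1`, so the coefficients are then summable. When `|E| ≥ p² + 1` a nonzero solution is not
even summable. In that range each series in the energy conditions belonging to a nonzero solution
diverges and has the default value `0`, so the conditions read `E c_0 = 0` and then `k_5 = 0`: only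
the zero solution survives (`IsCoeff.summable_of_energyCondition`). Hence the energy conditions
always force convergence.

Existence: the energy conditions are a homogeneous 2×2 system in `(c_0, k_5)`. Its determinant `AD -
BC` is continuous in `E` on `[-1, 5/2]` because the coefficients are bounded by `(19/20)^m` there.
The entry `A` is close to `1/(1+r+r²) - E`, `D` is close to `-1`, and `BC` is small, so the
determinant changes sign between `E = -1` and `E = 5/2` (`E = 2` for `p = 2`), and the intermediate
value theorem applies. -/

namespace PAdicSchrodinger

/-! ### Asymptotically constant two-term recursions -/

/-- A two-term recursion whose coefficients converge to those of a recursion with both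
characteristic roots in the open unit disc has summable solutions. -/
theorem summable_norm_of_rec_tendsto {u : ℕ → ℂ} {z₁ z₂ : ℂ} (h₁ : ‖z₁‖ < 1) (h₂ : ‖z₂‖ < 1)
    {α β : ℕ → ℂ} (hα : Filter.Tendsto α Filter.atTop (nhds (z₁ + z₂)))
    (hβ : Filter.Tendsto β Filter.atTop (nhds (z₁ * z₂)))
    (hu : ∀ m, u (m + 2) = α m * u (m + 1) - β m * u m) : Summable fun m => ‖u m‖ := by
  obtain ⟨ρ, hρ1, hρ2, hρ⟩ : ∃ ρ : ℝ, ‖z₁‖ ≤ ρ ∧ ‖z₂‖ ≤ ρ ∧ ρ < 1 :=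
    ⟨max ‖z₁‖ ‖z₂‖, le_max_left _ _, le_max_right _ _, max_lt h₁ h₂⟩
  have hρ0 : 0 ≤ ρ := (norm_nonneg _).trans hρ1
  -- The gap is split in three, `ρ = 1 - 3κ`: one `κ` pays for the coupling of `d` and `u`, one
  -- absorbs the perturbation `ε ≤ κ`, and the last is the contraction rate of `W`.
  obtain ⟨κ, hκ⟩ : ∃ κ : ℝ, κ = (1 - ρ) / 3 := ⟨_, rfl⟩
  have hκ0 : 0 < κ := by rw [hκ]; linarith
  obtain ⟨ε, hε⟩ : ∃ ε : ℝ, ε = κ * κ / 2 := ⟨_, rfl⟩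
  have hε0 : 0 < ε := by rw [hε]; positivity
  have hκ1 : κ ≤ 1 / 3 := by rw [hκ]; linarith
  have hεκ : ε ≤ κ := by rw [hε]; nlinarith
  have e1 := (Metric.tendsto_atTop.1 hα) ε hε0
  have e2 := (Metric.tendsto_atTop.1 hβ) ε hε0
  obtain ⟨N₁, hN₁⟩ := e1
  obtain ⟨N₂, hN₂⟩ := e2
  obtain ⟨N, hN1, hN2⟩ : ∃ N, N₁ ≤ N ∧ N₂ ≤ N := ⟨max N₁ N₂, le_max_left _ _, le_max_right _ _⟩
  -- `d` factors the limit recursion into two first-order ones with multipliers `z₁` and `z₂`. The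
  -- small weight `κ` in `W` makes the triangular system a contraction in a weighted norm, so no
  -- diagonalisation is needed and a double root is harmless.
  let d : ℕ → ℂ := fun m => u (m + 1) - z₁ * u m
  let W : ℕ → ℝ := fun m => ‖d (m + N)‖ + κ * ‖u (m + N)‖
  have hu1 : ∀ m, ‖u (m + 1)‖ ≤ ‖d m‖ + ρ * ‖u m‖ := by
    intro m
    have : u (m + 1) = d m + z₁ * u m := by simp [d]
    rw [this]
    refine (norm_add_le _ _).trans ?_
    rw [norm_mul]
    gcongr
  have hd1 : ∀ m, N ≤ m → ‖d (m + 1)‖ ≤ ρ * ‖d m‖ + ε * (‖u (m + 1)‖ + ‖u m‖) := by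
    intro m hm
    have : d (m + 1) = z₂ * d m + ((α m - (z₁ + z₂)) * u (m + 1) - (β m - z₁ * z₂) * u m) := by
      simp only [d, hu m]; ring
    rw [this]
    have a1 := hN₁ m (by omega)
    have a2 := hN₂ m (by omega)
    rw [dist_eq_norm] at a1 a2
    refine (norm_add_le _ _).trans (add_le_add ?_ ((norm_sub_le _ _).trans ?_))
    · rw [norm_mul]; gcongr
    · rw [norm_mul, norm_mul, mul_add]; gcongr
  have hW : ∀ m, W (m + 1) ≤ (1 - κ) * W m := by
    intro m
    have b1 := hu1 (m + N)
    have b2 := hd1 (m + N) (by omega)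
    have hb0 := norm_nonneg (u (m + N))
    have hd0 := norm_nonneg (d (m + N))
    have e : m + 1 + N = m + N + 1 := by ring
    simp only [W, e]
    have hρκ : ρ = 1 - 3 * κ := by rw [hκ]; ring
    have b3 : ‖d (m + N + 1)‖ + κ * ‖u (m + N + 1)‖ ≤
        ρ * ‖d (m + N)‖ + ε * ‖u (m + N)‖ + (ε + κ) * (‖d (m + N)‖ + ρ * ‖u (m + N)‖) := by
      nlinarith
    refine b3.trans ?_
    have c1 : ρ + (ε + κ) ≤ 1 - κ := by linarith
    have c2 : ε + (ε + κ) * ρ ≤ (1 - κ) * κ := by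
      rw [hρκ, hε]; nlinarith [mul_pos hκ0 hκ0, mul_pos (mul_pos hκ0 hκ0) hκ0]
    nlinarith [mul_le_mul_of_nonneg_right c1 hd0, mul_le_mul_of_nonneg_right c2 hb0]
  have hW2 : ∀ m, W m ≤ (1 - κ) ^ m * W 0 := by
    intro m
    induction m with
    | zero => simp
    | succ m ih =>
      refine (hW m).trans ?_
      rw [pow_succ']
      have : 0 ≤ 1 - κ := by linarith
      nlinarith
  have hs : Summable fun m => ‖u (m + N)‖ := by
    have hg : Summable fun m : ℕ => (1 - κ) ^ m * W 0 / κ :=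
      ((summable_geometric_of_lt_one (by linarith) (by linarith)).mul_right _).div_const _
    refine hg.of_nonneg_of_le (fun _ => norm_nonneg _) fun m => ?_
    rw [le_div_iff₀ hκ0]
    have := hW2 m
    simp only [W] at this ⊢
    have hd0 := norm_nonneg (d (m + N))
    linarith
  exact (summable_nat_add_iff N).1 hs

/-- Schur's criterion for `z² - a z + b`. If the roots are real, positivity at `±1` together with
product `b < 1` puts both in `(-1, 1)`; if they are conjugate, their squared modulus is `b`. -/
theorem exists_roots_norm_lt_one {a b : ℝ} (hb0 : 0 < b) (hb : b < 1) (ha : |a| < 1 + b) :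
    ∃ z₁ z₂ : ℂ, ‖z₁‖ < 1 ∧ ‖z₂‖ < 1 ∧ z₁ + z₂ = a ∧ z₁ * z₂ = b := by
  obtain ⟨ha1, ha2⟩ := abs_lt.1 ha
  rcases le_or_gt 0 (a ^ 2 - 4 * b) with h | h
  · obtain ⟨s, hs0, hs⟩ : ∃ s : ℝ, 0 ≤ s ∧ s ^ 2 = a ^ 2 - 4 * b :=
      ⟨√(a ^ 2 - 4 * b), Real.sqrt_nonneg _, Real.sq_sqrt h⟩
    refine ⟨((a + s) / 2 : ℝ), ((a - s) / 2 : ℝ), ?_, ?_, ?_, ?_⟩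
    · rw [Complex.norm_real, Real.norm_eq_abs, abs_lt]
      constructor <;> nlinarith
    · rw [Complex.norm_real, Real.norm_eq_abs, abs_lt]
      constructor <;> nlinarith
    · rw [← Complex.ofReal_add]; congr 1; ring
    · rw [← Complex.ofReal_mul]; congr 1; nlinarith
  · obtain ⟨s, hs0, hs⟩ : ∃ s : ℝ, 0 ≤ s ∧ s ^ 2 = 4 * b - a ^ 2 :=
      ⟨√(4 * b - a ^ 2), Real.sqrt_nonneg _, Real.sq_sqrt (by linarith)⟩
    have key : ∀ x y : ℝ, x ^ 2 + y ^ 2 = b → ‖(⟨x, y⟩ : ℂ)‖ < 1 := by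
      intro x y hxy
      rw [← sq_lt_one_iff₀ (norm_nonneg _), Complex.sq_norm, Complex.normSq_mk]
      nlinarith
    refine ⟨⟨a / 2, s / 2⟩, ⟨a / 2, -(s / 2)⟩, key _ _ (by nlinarith), key _ _ (by nlinarith),
      ?_, ?_⟩
    · apply Complex.ext <;> simp
    · apply Complex.ext <;> simp <;> nlinarith

/-- Schur stability of an asymptotically constant two-term recursion. -/
theorem summable_of_rec_tendsto {u : ℕ → ℝ} {a b : ℝ} (hb0 : 0 < b) (hb : b < 1)
    (ha : |a| < 1 + b) {α β : ℕ → ℝ} (hα : Filter.Tendsto α Filter.atTop (nhds a))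
    (hβ : Filter.Tendsto β Filter.atTop (nhds b))
    (hu : ∀ m, u (m + 2) = α m * u (m + 1) - β m * u m) : Summable u := by
  obtain ⟨z₁, z₂, h₁, h₂, h₃, h₄⟩ := exists_roots_norm_lt_one hb0 hb ha
  have := summable_norm_of_rec_tendsto (u := fun m => (u m : ℂ)) (α := fun m => (α m : ℂ))
    (β := fun m => (β m : ℂ)) h₁ h₂
    (by rw [h₃]; exact (Complex.continuous_ofReal.tendsto _).comp hα)
    (by rw [h₄]; exact (Complex.continuous_ofReal.tendsto _).comp hβ)
    (by intro m; rw [hu m]; push_cast; rfl)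
  simp only [Complex.norm_real] at this
  exact this.of_norm

/-- If the coefficients are bounded below as in a recursion with characteristic roots `1` and `t`,
up to a geometrically small error, then a solution does not tend to zero. -/
theorem not_summable_of_rec {u α β d e : ℕ → ℝ} {t : ℝ} (ht0 : 0 ≤ t) (ht : t ≤ 1 / 4)
    (hu : ∀ m, u (m + 2) = α m * u (m + 1) - β m * u m)
    (hα : ∀ m, (1 + t) * (1 - d m) ≤ |α m|) (hβ0 : ∀ m, 0 ≤ β m)
    (hβ : ∀ m, β m ≤ t * (1 + e m)) (hd0 : ∀ m, 0 ≤ d m) (he0 : ∀ m, 0 ≤ e m)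
    (hde : ∀ m, 5 / 4 * d m + e m / 3 ≤ 1 / 12 * (2 / 3) ^ m)
    (h01 : |u 0| ≤ |u 1|) (h0 : u 0 ≠ 0) : ¬ Summable u := by
  have hq : ∀ m : ℕ, 0 < (2 / 3 : ℝ) ^ m ∧ (2 / 3 : ℝ) ^ m ≤ 1 := fun m =>
    ⟨by positivity, pow_le_one₀ (by norm_num) (by norm_num)⟩
  -- Successive ratios may dip below `1`, but only by a summable amount, so their product stays away
  -- from `0`. This covers the borderline case of a root of modulus exactly `1`.
  have ratio : ∀ m, (1 - 1 / 4 * (2 / 3) ^ m) * |u m| ≤ |u (m + 1)| := by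
    intro m
    induction m with
    | zero => simp only [pow_zero, zero_add]; nlinarith [abs_nonneg (u 0)]
    | succ m ih =>
      obtain ⟨q0, q1⟩ := hq m
      have h1 : |u (m + 2)| ≥ |α m| * |u (m + 1)| - β m * |u m| := by
        rw [hu m]
        have := abs_sub_abs_le_abs_sub (α m * u (m + 1)) (β m * u m)
        rw [abs_mul, abs_mul, abs_of_nonneg (hβ0 m)] at this
        exact this
      rw [pow_succ]
      set q : ℝ := (2 / 3) ^ m
      have hA := abs_nonneg (u (m + 1))
      have hB := abs_nonneg (u m)
      have h2 : |u m| ≤ (1 + 1 / 3 * q) * |u (m + 1)| := by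
        have : 1 ≤ (1 + 1 / 3 * q) * (1 - 1 / 4 * q) := by nlinarith
        calc |u m| ≤ ((1 + 1 / 3 * q) * (1 - 1 / 4 * q)) * |u m| := by nlinarith
          _ = (1 + 1 / 3 * q) * ((1 - 1 / 4 * q) * |u m|) := by ring
          _ ≤ _ := by gcongr
      have h3 : β m * |u m| ≤ t * (1 + e m) * ((1 + 1 / 3 * q) * |u (m + 1)|) := by
        have := hβ m
        have := hβ0 m
        have := he0 m
        gcongr
      have h4 : (1 + t) * (1 - d m) * |u (m + 1)| ≤ |α m| * |u (m + 1)| := by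
        gcongr; exact hα m
      -- Since `1 + t ≤ 5/4` and `t ≤ 1/4`, the loss is at most `5/4 d + e/3 + q/12 ≤ q/6`, which is
      -- `1/4` times the next power of `2/3`. This is where the weights in `hde` come from.
      have h5 : 1 - 1 / 4 * (q * (2 / 3)) ≤
          (1 + t) * (1 - d m) - t * (1 + e m) * (1 + 1 / 3 * q) := by
        have hdm := hd0 m
        have hem := he0 m
        have := hde m
        have k1 : (1 + e m) * (1 + 1 / 3 * q) - 1 ≤ 4 / 3 * e m + 1 / 3 * q := by nlinarith
        have k2 : t * ((1 + e m) * (1 + 1 / 3 * q) - 1) ≤ 1 / 4 * (4 / 3 * e m + 1 / 3 * q) :=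
          (mul_le_mul_of_nonneg_left k1 ht0).trans (by gcongr)
        nlinarith
      nlinarith [mul_le_mul_of_nonneg_right h5 hA]
  -- An explicit lower bound for the infinite product of the factors `1 - (2/3)^m / 4`, in a form
  -- that passes through the induction.
  have lower : ∀ m, (1 / 4 + 3 / 4 * (2 / 3) ^ m) * |u 0| ≤ |u m| := by
    intro m
    induction m with
    | zero => norm_num
    | succ m ih =>
      obtain ⟨q0, q1⟩ := hq m
      refine le_trans ?_ (ratio m)
      rw [pow_succ]
      set q : ℝ := (2 / 3) ^ m
      have hB := abs_nonneg (u 0)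
      have : 1 / 4 + 3 / 4 * (q * (2 / 3)) ≤ (1 - 1 / 4 * q) * (1 / 4 + 3 / 4 * q) := by nlinarith
      calc _ ≤ ((1 - 1 / 4 * q) * (1 / 4 + 3 / 4 * q)) * |u 0| := by gcongr
        _ = (1 - 1 / 4 * q) * ((1 / 4 + 3 / 4 * q) * |u 0|) := by ring
        _ ≤ _ := by
          have : 0 ≤ 1 - 1 / 4 * q := by linarith
          gcongr
  intro hs
  have h := hs.tendsto_atTop_zero.abs
  rw [abs_zero] at h
  have hpos : 0 < |u 0| := abs_pos.2 h0
  have := ge_of_tendsto h (b := 1 / 4 * |u 0|) (Filter.Eventually.of_forall fun m => by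
    refine le_trans ?_ (lower m)
    have := (hq m).1
    gcongr
    linarith)
  linarith

/-- A two-term recursion that is dominated by a geometric sequence. -/
theorem abs_le_pow_of_rec {u α β : ℕ → ℝ} {a b θ : ℝ} (ha : 0 ≤ a) (hb : 0 ≤ b) (hθ : 0 ≤ θ)
    (hab : a * θ + b ≤ θ ^ 2) (hu : ∀ m, u (m + 2) = α m * u (m + 1) - β m * u m)
    (hα : ∀ m, |α m| ≤ a) (hβ : ∀ m, |β m| ≤ b) (h0 : |u 0| ≤ 1) (h1 : |u 1| ≤ θ) (m : ℕ) :
    |u m| ≤ θ ^ m := by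
  induction m using Nat.strong_induction_on with
  | _ m ih =>
    match m with
    | 0 => simpa using h0
    | 1 => simpa using h1
    | m + 2 =>
      rw [hu m]
      refine (abs_sub _ _).trans ?_
      rw [abs_mul, abs_mul]
      calc _ ≤ a * θ ^ (m + 1) + b * θ ^ m := by
            gcongr
            · exact hα m
            · exact ih _ (by omega)
            · exact hβ m
            · exact ih _ (by omega)
        _ = θ ^ m * (a * θ + b) := by ring
        _ ≤ θ ^ m * θ ^ 2 := by gcongr
        _ = _ := by ring

/-- The sum of a solution of a contracting two-term recursion is controlled by its first terms. -/
theorem tsum_abs_le_of_rec {u : ℕ → ℝ} {a b : ℝ} (hs : Summable u)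
    (hu : ∀ m, |u (m + 2)| ≤ a * |u (m + 1)| + b * |u m|) :
    (1 - a - b) * ∑' m, |u m| ≤ (1 - a) * |u 0| + |u 1| := by
  have hs0 : Summable fun m => |u m| := hs.abs
  have hs1 : Summable fun m => |u (m + 1)| := (summable_nat_add_iff 1).2 hs0
  have hs2 : Summable fun m => |u (m + 2)| := (summable_nat_add_iff 2).2 hs0
  have e0 : ∑' m, |u m| = |u 0| + ∑' m, |u (m + 1)| := hs0.tsum_eq_zero_add
  have e1 : ∑' m, |u (m + 1)| = |u 1| + ∑' m, |u (m + 2)| := hs1.tsum_eq_zero_add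
  have h : ∑' m, |u (m + 2)| ≤ ∑' m, (a * |u (m + 1)| + b * |u m|) :=
    hs2.tsum_le_tsum hu ((hs1.mul_left a).add (hs0.mul_left b))
  rw [(hs1.mul_left a).tsum_add (hs0.mul_left b), tsum_mul_left, tsum_mul_left] at h
  have e2 : a * ∑' m, |u m| = a * |u 0| + a * ∑' m, |u (m + 1)| := by rw [e0, mul_add]
  linarith

/-! ### The Gamma ratios and the normalised recursions -/

/-- The correction factor in `Γ_p(2m+3)/Γ_p(2m+1) = P² growthFactor P m`. -/
noncomputable def growthFactor (P : ℝ) (m : ℕ) : ℝ :=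
  (1 - (P ^ (2 * m + 1))⁻¹) * (1 - (P ^ (2 * m + 2))⁻¹) /
    ((1 - (P ^ (2 * m))⁻¹) * (1 - (P ^ (2 * m + 3))⁻¹))

theorem one_sub_inv_pow_pos {P : ℝ} (hP : 2 ≤ P) {n : ℕ} (hn : n ≠ 0) : 0 < 1 - (P ^ n)⁻¹ :=
  sub_pos.2 (inv_lt_one_of_one_lt₀ (one_lt_pow₀ (by linarith) hn))

theorem inv_sq_pow_le {P : ℝ} (hP : 2 ≤ P) (m : ℕ) : (P ^ (2 * m))⁻¹ ≤ (1 / 4) ^ m := by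
  rw [pow_mul, ← inv_pow, one_div]
  have : (P ^ 2)⁻¹ ≤ 4⁻¹ := inv_anti₀ (by norm_num) (by nlinarith)
  have h0 : 0 ≤ (P ^ 2)⁻¹ := by positivity
  gcongr

/-- With `x = P^(-2m)` and `y = P⁻¹`, numerator minus denominator is `x (1 - y)(1 - y²) ≥ 0`. For
the upper bound the numerator is at most `1`, and `(1 + 2x)(1 - x)(1 - x/8) ≥ 1` for `x ≤ 1/4`. -/
theorem growthFactor_bounds' {P : ℝ} (hP : 2 ≤ P) {m : ℕ} (hm : 1 ≤ m) :
    1 ≤ growthFactor P m ∧ growthFactor P m ≤ 1 + 2 * (P ^ (2 * m))⁻¹ := by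
  have hx := inv_sq_pow_le hP m
  have hx4 : ((1 / 4 : ℝ)) ^ m ≤ 1 / 4 := pow_le_of_le_one (by norm_num) (by norm_num) (by omega)
  have hd1 := one_sub_inv_pow_pos hP (n := 2 * m) (by omega)
  have hd2 := one_sub_inv_pow_pos hP (n := 2 * m + 3) (by omega)
  have hx0 : 0 < (P ^ (2 * m))⁻¹ := by positivity
  have hy : P⁻¹ ≤ 1 / 2 := by
    rw [one_div]; exact inv_anti₀ (by norm_num) hP
  have hy0 : 0 < P⁻¹ := by positivity
  unfold growthFactor
  rw [one_le_div (mul_pos hd1 hd2), div_le_iff₀ (mul_pos hd1 hd2)]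
  simp only [pow_add, mul_inv, pow_one, ← inv_pow P 2, ← inv_pow P 3] at *
  set x := (P ^ (2 * m))⁻¹
  set y := P⁻¹
  have hy3 : y ^ 3 ≤ 1 / 8 := by nlinarith [pow_le_pow_left₀ hy0.le hy 3]
  constructor
  · have h : 0 ≤ x * ((1 - y) * (1 - y ^ 2)) := by
      have : 0 ≤ 1 - y := by linarith
      have : 0 ≤ 1 - y ^ 2 := by nlinarith
      positivity
    nlinarith
  · have h1 : (1 - x * y) * (1 - x * y ^ 2) ≤ 1 := by
      have : 0 < x * y := by positivity
      have : x * y ≤ 1 := by nlinarith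
      have : 0 < x * y ^ 2 := by positivity
      nlinarith
    have h2 : 1 ≤ (1 + 2 * x) * ((1 - x) * (1 - x * y ^ 3)) := by
      have a1 : x * y ^ 3 ≤ x * (1 / 8) := by gcongr
      have a2 : 0 < x * y ^ 3 := by positivity
      have a3 : 0 ≤ (1 + 2 * x) * (1 - x) := by nlinarith
      have a4 : (1 + 2 * x) * (1 - x) * (1 - x * (1 / 8)) ≤
          (1 + 2 * x) * (1 - x) * (1 - x * y ^ 3) := by gcongr
      have a5 : 1 ≤ (1 + 2 * x) * (1 - x) * (1 - x * (1 / 8)) := by nlinarith [mul_pos hx0 hx0]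
      linarith
    calc _ ≤ (1 : ℝ) := h1
      _ ≤ _ := h2

theorem growthFactor_bounds {P : ℝ} (hP : 2 ≤ P) {m : ℕ} (hm : 1 ≤ m) :
    1 ≤ growthFactor P m ∧ growthFactor P m ≤ 1 + 2 * (1 / 4) ^ m := by
  obtain ⟨h1, h2⟩ := growthFactor_bounds' hP hm
  exact ⟨h1, h2.trans (by have := inv_sq_pow_le hP m; linarith)⟩

theorem growthFactor_pos {P : ℝ} (hP : 2 ≤ P) {m : ℕ} (hm : 1 ≤ m) : 0 < growthFactor P m :=
  one_pos.trans_le (growthFactor_bounds hP hm).1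

theorem tendsto_growthFactor {P : ℝ} (hP : 2 ≤ P) (k : ℕ) :
    Filter.Tendsto (fun m => growthFactor P (m + k + 1)) Filter.atTop (nhds 1) := by
  have h : Filter.Tendsto (fun m : ℕ => 1 + 2 * (1 / 4 : ℝ) ^ (m + (k + 1))) Filter.atTop
      (nhds (1 + 2 * 0)) :=
    (((tendsto_pow_atTop_nhds_zero_of_lt_one (by norm_num) (by norm_num)).comp
      (Filter.tendsto_add_atTop_nat (k + 1))).const_mul 2).const_add 1
  rw [mul_zero, add_zero] at h
  exact tendsto_of_tendsto_of_tendsto_of_le_of_le tendsto_const_nhds h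
    (fun m => (growthFactor_bounds hP (by omega)).1)
    (fun m => (growthFactor_bounds hP (by omega)).2)

/-- The recursion for the coefficients of the even powers of `|x|_p` on the unit ball. -/
structure IsInnerRec (P E : ℝ) (u : ℕ → ℝ) : Prop where
  one : u 1 = 0
  step : ∀ m, P ^ 2 * growthFactor P (m + 1) * u (m + 2) = E * u (m + 1) - u m

/-- The recursion for the rescaled coefficients of `|x|_p ^ (-(2m+5))` off the unit ball. -/
structure IsOuterRec (P E : ℝ) (u : ℕ → ℝ) : Prop where
  one : P ^ 2 * u 1 = E * u 0
  step : ∀ m, P ^ 2 * u (m + 2) = E * u (m + 1) - growthFactor P (m + 2) * u m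

theorem IsInnerRec.step' {P E : ℝ} {u : ℕ → ℝ} (hP : 2 ≤ P) (h : IsInnerRec P E u) (m : ℕ) :
    u (m + 2) = E / (P ^ 2 * growthFactor P (m + 1)) * u (m + 1) -
      1 / (P ^ 2 * growthFactor P (m + 1)) * u m := by
  have hg := growthFactor_pos hP (m := m + 1) (by omega)
  have := h.step m
  field_simp
  linarith

theorem IsOuterRec.step' {P E : ℝ} {u : ℕ → ℝ} (hP : 2 ≤ P) (h : IsOuterRec P E u) (m : ℕ) :
    u (m + 2) = E / P ^ 2 * u (m + 1) - growthFactor P (m + 2) / P ^ 2 * u m := by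
  have := h.step m
  field_simp
  linarith

/-! ### The threshold `|E| = P² + 1` for summability -/

section Summability

variable {P E : ℝ} {u : ℕ → ℝ}

/-- This is Schur's condition `|a| < 1 + b` for the limit polynomial, with `a = E/P²` and `b =
1/P²`. -/
theorem abs_div_sq_lt (hP : 2 ≤ P) (hE : |E| < P ^ 2 + 1) : |E / P ^ 2| < 1 + 1 / P ^ 2 := by
  rw [abs_div, abs_of_pos (by positivity : (0 : ℝ) < P ^ 2), div_lt_iff₀ (by positivity)]
  field_simp
  linarith

theorem one_div_sq_mem (hP : 2 ≤ P) : 0 < 1 / P ^ 2 ∧ 1 / P ^ 2 ≤ 1 / 4 :=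
  ⟨by positivity, one_div_le_one_div_of_le (by norm_num) (by nlinarith)⟩

theorem IsInnerRec.summable (hP : 2 ≤ P) (hE : |E| < P ^ 2 + 1) (h : IsInnerRec P E u) :
    Summable u := by
  have ht : Filter.Tendsto (fun m => P ^ 2 * growthFactor P (m + 1)) Filter.atTop
      (nhds (P ^ 2 * 1)) := (tendsto_growthFactor hP 0).const_mul _
  rw [mul_one] at ht
  have hP2 : P ^ 2 ≠ 0 := by positivity
  obtain ⟨h1, h2⟩ := one_div_sq_mem hP
  exact summable_of_rec_tendsto h1 (h2.trans_lt (by norm_num)) (abs_div_sq_lt hP hE)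
    (tendsto_const_nhds.div ht hP2) (tendsto_const_nhds.div ht hP2) (h.step' hP)

theorem IsOuterRec.summable (hP : 2 ≤ P) (hE : |E| < P ^ 2 + 1) (h : IsOuterRec P E u) :
    Summable u := by
  obtain ⟨h1, h2⟩ := one_div_sq_mem hP
  exact summable_of_rec_tendsto h1 (h2.trans_lt (by norm_num)) (abs_div_sq_lt hP hE)
    tendsto_const_nhds ((tendsto_growthFactor hP 1).div_const (P ^ 2)) (h.step' hP)

/-- At `|E| = P² + 1` the limit polynomial has a root `±1`, so convergence of the coefficients alone
decides nothing; the geometric rate at which `growthFactor` tends to `1` does. -/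
theorem IsOuterRec.not_summable (hP : 2 ≤ P) (hE : P ^ 2 + 1 ≤ |E|) (h : IsOuterRec P E u)
    (h0 : u 0 ≠ 0) : ¬ Summable u := by
  obtain ⟨h1, h2⟩ := one_div_sq_mem hP
  have hP2 : 0 < P ^ 2 := by positivity
  have hEP : 1 + 1 / P ^ 2 ≤ |E / P ^ 2| := by
    rw [abs_div, abs_of_pos hP2, le_div_iff₀ hP2]
    field_simp
    linarith
  refine not_summable_of_rec (d := fun _ => 0) (e := fun m => 2 * (1 / 4) ^ (m + 2)) h1.le h2
    (h.step' hP) (fun m => by simpa using hEP)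
    (fun m => div_nonneg (growthFactor_pos hP (by omega)).le hP2.le) (fun m => ?_)
    (fun _ => le_rfl) (fun _ => by positivity) (fun m => ?_) ?_ h0
  · rw [div_mul_eq_mul_div, one_mul]
    gcongr
    exact (growthFactor_bounds hP (by omega)).2
  · have : (1 / 4 : ℝ) ^ m ≤ (2 / 3) ^ m := by gcongr <;> norm_num
    rw [pow_add]
    linarith [pow_pos (by norm_num : (0 : ℝ) < 2 / 3) m]
  · have h3 : u 1 = E / P ^ 2 * u 0 := by
      have := h.one
      field_simp
      linarith
    rw [h3, abs_mul]
    nlinarith [abs_nonneg (u 0)]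

theorem IsInnerRec.not_summable (hP : 2 ≤ P) (hE : P ^ 2 + 1 ≤ |E|) (h : IsInnerRec P E u)
    (h0 : u 0 ≠ 0) : ¬ Summable u := by
  obtain ⟨h1, h2⟩ := one_div_sq_mem hP
  have hP2 : 0 < P ^ 2 := by positivity
  have hg : ∀ m, 0 < growthFactor P (m + 1) := fun m => growthFactor_pos hP (by omega)
  have hα : ∀ m, (1 + 1 / P ^ 2) * (1 - 2 * (1 / 4) ^ (m + 1)) ≤
      |E / (P ^ 2 * growthFactor P (m + 1))| := by
    intro m
    obtain ⟨b1, b2⟩ := growthFactor_bounds hP (m := m + 1) (by omega)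
    rw [abs_div, abs_of_pos (mul_pos hP2 (hg m)), le_div_iff₀ (mul_pos hP2 (hg m))]
    set q : ℝ := (1 / 4) ^ (m + 1)
    have : (1 - 2 * q) * growthFactor P (m + 1) ≤ 1 := by
      nlinarith [show (0 : ℝ) < q from by positivity, mul_self_nonneg q]
    calc _ = (P ^ 2 + 1) * ((1 - 2 * q) * growthFactor P (m + 1)) := by field_simp
      _ ≤ (P ^ 2 + 1) * 1 := by gcongr
      _ ≤ _ := by linarith
  -- Since `u 1 = 0`, growth can only start at `u 2`, a nonzero multiple of `u 0`.
  rw [← summable_nat_add_iff 2]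
  have h22 : u (0 + 2) ≠ 0 := by
    rw [h.step' hP 0, zero_add, h.one]
    have := hg 0
    simp only [mul_zero, zero_sub, neg_ne_zero]
    exact mul_ne_zero (by positivity) h0
  refine not_summable_of_rec (u := fun m => u (m + 2))
    (d := fun m => 2 * (1 / 4) ^ (m + 2 + 1)) (e := fun _ => 0) h1.le h2
    (fun m => h.step' hP (m + 2)) (fun m => hα (m + 2))
    (fun m => div_nonneg zero_le_one (mul_pos hP2 (hg _)).le) (fun m => ?_)
    (fun _ => by positivity) (fun _ => le_rfl) (fun m => ?_) ?_ h22
  · rw [add_zero, mul_one]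
    have := (growthFactor_bounds hP (m := m + 2 + 1) (by omega)).1
    gcongr
    nlinarith
  · have : (1 / 4 : ℝ) ^ m ≤ (2 / 3) ^ m := by gcongr <;> norm_num
    rw [pow_add, pow_add]
    linarith [pow_pos (by norm_num : (0 : ℝ) < 2 / 3) m]
  · have h3 : u (0 + 1 + 2) = E / (P ^ 2 * growthFactor P 2) * u (0 + 2) := by
      have := h.step' hP 1
      rw [h.one] at this
      simpa using this
    -- The bound depending on `P` is needed here: it gives `P² growthFactor P 2 ≤ P² + 2/P² ≤ P² +
    -- 1`, while the uniform bound would lose a multiple of `P²`.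
    have h4 := (growthFactor_bounds' hP (m := 2) (by norm_num)).2
    have hg2 := hg 1
    show |u (0 + 2)| ≤ |u (0 + 1 + 2)|
    rw [h3, abs_mul]
    have : 1 ≤ |E / (P ^ 2 * growthFactor P 2)| := by
      rw [abs_div, abs_of_pos (mul_pos hP2 hg2), one_le_div (mul_pos hP2 hg2)]
      refine le_trans ?_ hE
      calc P ^ 2 * growthFactor P 2 ≤ P ^ 2 * (1 + 2 * (P ^ (2 * 2))⁻¹) := by gcongr
        _ = P ^ 2 + 2 * (1 / P ^ 2) := by field_simp
        _ ≤ _ := by linarith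
    nlinarith [abs_nonneg (u (0 + 2))]

end Summability

/-! ### Haar measure of balls and spheres, radial integrals -/

section Haar

variable (p : ℕ) [hp : Fact p.Prime]

instance : (haar p).IsAddHaarMeasure := by unfold haar; infer_instance

theorem haar_closedBall_one : haar p (Metric.closedBall 0 1) = 1 :=
  Measure.addHaarMeasure_self (K₀ := unitBall p)

theorem two_le_prime : (2 : ℝ) ≤ p := by exact_mod_cast hp.out.two_le

/-- A ball of radius `p ^ (j + 1)` is the disjoint union of `p` translates of one of radius
`p ^ j`. -/
theorem haar_closedBall_succ (j : ℤ) :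
    haar p (Metric.closedBall 0 ((p : ℝ) ^ (j + 1))) =
      p * haar p (Metric.closedBall 0 ((p : ℝ) ^ j)) := by
  have hp0 : (0 : ℝ) < p := by exact_mod_cast hp.out.pos
  have hpQ : (p : ℚ_[p]) ≠ 0 := by exact_mod_cast hp.out.ne_zero
  have hcov : Metric.closedBall (0 : ℚ_[p]) ((p : ℝ) ^ (j + 1)) =
      ⋃ a ∈ Finset.range p, (fun y => ((a : ℚ_[p]) * (p : ℚ_[p]) ^ (-(j + 1))) + y) ''
        Metric.closedBall (0 : ℚ_[p]) ((p : ℝ) ^ j) := by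
    ext x
    simp only [Metric.mem_closedBall, dist_zero_right, Set.mem_iUnion, Set.mem_image, exists_prop]
    have hn : ‖(p : ℚ_[p]) ^ (-(j + 1))‖ = (p : ℝ) ^ (j + 1) := by simp
    constructor
    · intro hx
      have hy : ‖x * (p : ℚ_[p]) ^ (j + 1)‖ ≤ 1 := by
        rw [norm_mul, Padic.norm_p_zpow, zpow_neg]
        rw [← div_eq_mul_inv, div_le_one (by positivity)]
        exact hx
      -- `a` is the leading digit of `x`: the residue of `x p^(j+1) ∈ ℤ_p` modulo `p`.
      obtain ⟨a, ⟨ha, ha'⟩, -⟩ := PadicInt.existsUnique_mem_range (⟨_, hy⟩ : ℤ_[p])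
      refine ⟨a, Finset.mem_range.2 ha, x - a * (p : ℚ_[p]) ^ (-(j + 1)), ?_, by ring⟩
      have h1 : ‖x * (p : ℚ_[p]) ^ (j + 1) - a‖ < 1 := by
        have := PadicInt.mem_nonunits.1 ((IsLocalRing.mem_maximalIdeal _).1 ha')
        rw [PadicInt.norm_def] at this
        exact this
      have h2 : ‖x * (p : ℚ_[p]) ^ (j + 1) - a‖ ≤ (p : ℝ) ^ (-1 : ℤ) := by
        rw [Padic.norm_le_pow_iff_norm_lt_pow_add_one]
        simpa using h1
      have h3 : x - a * (p : ℚ_[p]) ^ (-(j + 1)) =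
          (x * (p : ℚ_[p]) ^ (j + 1) - a) * (p : ℚ_[p]) ^ (-(j + 1)) := by
        rw [sub_mul, mul_assoc, ← zpow_add₀ hpQ]
        simp
      rw [h3, norm_mul, hn]
      calc _ ≤ (p : ℝ) ^ (-1 : ℤ) * (p : ℝ) ^ (j + 1) := by gcongr
        _ = (p : ℝ) ^ j := by rw [← zpow_add₀ hp0.ne']; congr 1; ring
    · rintro ⟨a, -, y, hy, rfl⟩
      refine (Padic.nonarchimedean _ _).trans (max_le ?_ (hy.trans ?_))
      · rw [norm_mul, hn]
        have := Padic.norm_int_le_one (p := p) (a : ℤ)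
        rw [Int.cast_natCast] at this
        have h0 : 0 ≤ (p : ℝ) ^ (j + 1) := by positivity
        nlinarith
      · exact zpow_le_zpow_right₀ (by exact_mod_cast hp.out.one_lt.le) (by omega)
  have hdisj : (↑(Finset.range p) : Set ℕ).PairwiseDisjoint fun a =>
      (fun y => ((a : ℚ_[p]) * (p : ℚ_[p]) ^ (-(j + 1))) + y) ''
        Metric.closedBall (0 : ℚ_[p]) ((p : ℝ) ^ j) := by
    intro a ha b hb hab
    rw [Function.onFun, Set.disjoint_left]
    rintro _ ⟨y, hy, rfl⟩ ⟨z, hz, hyz⟩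
    rw [Metric.mem_closedBall, dist_zero_right] at hy hz
    have e : ((b : ℚ_[p]) - a) * (p : ℚ_[p]) ^ (-(j + 1)) = y - z := by
      simp only at hyz
      linear_combination hyz
    have h1 : ‖y - z‖ ≤ (p : ℝ) ^ j := by
      have := Padic.nonarchimedean y (-z)
      rw [norm_neg, ← sub_eq_add_neg] at this
      exact this.trans (max_le hy hz)
    rw [← e, norm_mul, Padic.norm_p_zpow, neg_neg, zpow_add₀ hp0.ne', zpow_one] at h1
    have h2 : ‖((((b : ℤ) - a : ℤ)) : ℚ_[p])‖ < 1 := by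
      push_cast
      have hpj : 0 < (p : ℝ) ^ j := by positivity
      have hp1 : (1 : ℝ) < p := by exact_mod_cast hp.out.one_lt
      by_contra hcon
      have : (p : ℝ) ^ j * p ≤ ‖(b : ℚ_[p]) - a‖ * ((p : ℝ) ^ j * p) :=
        le_mul_of_one_le_left (by positivity) (not_lt.1 hcon)
      nlinarith
    rw [Padic.norm_intCast_lt_one_iff] at h2
    have ha' := Finset.mem_range.1 ha
    have hb' := Finset.mem_range.1 hb
    have h3 : (b : ℤ) - a = 0 := Int.eq_zero_of_abs_lt_dvd h2 (by rw [abs_lt]; omega)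
    omega
  rw [hcov, measure_biUnion_finset hdisj]
  · simp only [Set.image_add_left, measure_preimage_add]
    simp
  · intro a _
    rw [Set.image_add_left]
    exact (measurable_const_add _) Metric.isClosed_closedBall.measurableSet

theorem haar_closedBall (j : ℤ) :
    haar p (Metric.closedBall 0 ((p : ℝ) ^ j)) = ENNReal.ofReal ((p : ℝ) ^ j) := by
  have hp0 : (0 : ℝ) < p := by exact_mod_cast hp.out.pos
  have hpE : (p : ENNReal) = ENNReal.ofReal p := by simp
  induction j with
  | zero => simp [haar_closedBall_one]
  | succ j ih =>
    rw [haar_closedBall_succ, ih, hpE, ← ENNReal.ofReal_mul hp0.le, zpow_add₀ hp0.ne', zpow_one,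
      mul_comm]
  | pred j ih =>
    have h := haar_closedBall_succ p (-(j : ℤ) - 1)
    rw [sub_add_cancel, ih] at h
    have h2 : ENNReal.ofReal ((p : ℝ) ^ (-(j : ℤ))) =
        p * ENNReal.ofReal ((p : ℝ) ^ (-(j : ℤ) - 1)) := by
      rw [hpE, ← ENNReal.ofReal_mul hp0.le, zpow_sub_one₀ hp0.ne']
      congr 1
      field_simp
    rw [h2] at h
    exact ((ENNReal.mul_right_inj (by exact_mod_cast hp.out.ne_zero) (by simp)).1 h).symm

/-- The norm takes no value strictly between `p^(j-1)` and `p^j`, so the sphere is a difference of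
consecutive balls. -/
theorem haar_sphere (j : ℤ) :
    haar p (Metric.sphere 0 ((p : ℝ) ^ j)) = ENNReal.ofReal ((p : ℝ) ^ j * (1 - (p : ℝ)⁻¹)) := by
  have hp0 : (0 : ℝ) < p := by exact_mod_cast hp.out.pos
  have h : Metric.sphere (0 : ℚ_[p]) ((p : ℝ) ^ j) =
      Metric.closedBall 0 ((p : ℝ) ^ j) \ Metric.closedBall 0 ((p : ℝ) ^ (j - 1)) := by
    ext x
    simp only [Set.mem_sdiff, Metric.mem_closedBall, mem_sphere_iff_norm, sub_zero, dist_zero_right]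
    rw [Padic.norm_le_pow_iff_norm_lt_pow_add_one x (j - 1), sub_add_cancel, not_lt]
    exact ⟨fun h => ⟨h.le, h.ge⟩, fun h => le_antisymm h.1 h.2⟩
  rw [h, measure_sdiff (Metric.closedBall_subset_closedBall
    (zpow_le_zpow_right₀ (by exact_mod_cast hp.out.one_lt.le) (by omega)))
    Metric.isClosed_closedBall.measurableSet.nullMeasurableSet
    (by rw [haar_closedBall]; exact ENNReal.ofReal_ne_top), haar_closedBall, haar_closedBall,
    ← ENNReal.ofReal_sub _ (by positivity), zpow_sub_one₀ hp0.ne']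
  congr 1
  ring

/-- Integration of radial functions on `ℚ_p`. -/
theorem radial_integral {f : ℚ_[p] → ℂ} {g : ℤ → ℝ} {s : ℝ}
    (hf : ∀ y i, ‖y‖ = (p : ℝ) ^ i → f y = g i)
    (hg : Summable fun i => |(p : ℝ) ^ i * g i|)
    (hs : HasSum (fun i => (p : ℝ) ^ i * g i) s) :
    Integrable f (haar p) ∧ ∫ y, f y ∂(haar p) = ((1 - (p : ℝ)⁻¹) * s : ℝ) := by
  have hp0 : (0 : ℝ) < p := by exact_mod_cast hp.out.pos
  have hp1 : (1 : ℝ) < p := by exact_mod_cast hp.out.one_lt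
  have hN : 0 ≤ 1 - (p : ℝ)⁻¹ := by
    have := inv_lt_one_of_one_lt₀ hp1
    linarith
  let S : ℤ → Set ℚ_[p] := fun i => Metric.sphere 0 ((p : ℝ) ^ i)
  have hSm : ∀ i, MeasurableSet (S i) := fun i => Metric.isClosed_sphere.measurableSet
  have hSreal : ∀ i, (haar p).real (S i) = (p : ℝ) ^ i * (1 - (p : ℝ)⁻¹) := by
    intro i
    rw [Measure.real, haar_sphere, ENNReal.toReal_ofReal (by positivity)]
  have hSfin : ∀ i, haar p (S i) ≠ ⊤ := by
    intro i
    rw [haar_sphere]; exact ENNReal.ofReal_ne_top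
  have hfS : ∀ i, Set.EqOn f (fun _ => (g i : ℂ)) (S i) := by
    intro i y hy
    exact hf y i (by simpa [S] using hy)
  have hdisj : Pairwise (Function.onFun Disjoint S) := by
    intro i j hij
    rw [Function.onFun, Set.disjoint_left]
    intro x hx hy
    simp only [S, mem_sphere_iff_norm, sub_zero] at hx hy
    exact hij (zpow_right_injective₀ hp0 hp1.ne' (hx.symm.trans hy))
  have hU : (⋃ i, S i) = {0}ᶜ := by
    ext x
    simp only [S, Set.mem_iUnion, mem_sphere_iff_norm, sub_zero, Set.mem_compl_iff,
      Set.mem_singleton_iff]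
    constructor
    · rintro ⟨i, hi⟩ rfl
      rw [norm_zero] at hi
      exact (zpow_pos hp0 i).ne hi
    · intro hx
      exact ⟨-x.valuation, Padic.norm_eq_zpow_neg_valuation hx⟩
  have h0 : haar p {(0 : ℚ_[p])} = 0 := by
    have h1 : Filter.Tendsto (fun n : ℕ => ENNReal.ofReal ((p : ℝ)⁻¹ ^ n)) Filter.atTop
        (nhds (ENNReal.ofReal 0)) :=
      ENNReal.tendsto_ofReal (tendsto_pow_atTop_nhds_zero_of_lt_one (by positivity)
        (inv_lt_one_of_one_lt₀ hp1))
    rw [ENNReal.ofReal_zero] at h1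
    refine le_antisymm (ge_of_tendsto' h1 fun n => ?_) zero_le
    rw [inv_pow, ← zpow_natCast, ← zpow_neg, ← haar_closedBall]
    exact measure_mono (by simp)
  have hres : (haar p).restrict (⋃ i, S i) = haar p := by
    rw [hU]
    exact Measure.restrict_eq_self_of_ae_mem (by simp [ae_iff, h0])
  have hint : ∀ i, IntegrableOn f (S i) (haar p) := fun i =>
    (integrableOn_congr_fun (hfS i) (hSm i)).2 (integrableOn_const (hSfin i))
  have hnorm : ∀ i, ∫ y in S i, ‖f y‖ ∂(haar p) = (1 - (p : ℝ)⁻¹) * |(p : ℝ) ^ i * g i| := by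
    intro i
    rw [setIntegral_congr_fun (g := fun _ => |g i|) (hSm i)
      (fun y hy => by simp only [hfS i hy, Complex.norm_real, Real.norm_eq_abs]),
      setIntegral_const, hSreal, abs_mul, abs_of_pos (zpow_pos hp0 i), smul_eq_mul]
    ring
  have hI : IntegrableOn f (⋃ i, S i) (haar p) :=
    integrableOn_iUnion_of_summable_integral_norm hint
      (by simpa only [hnorm] using hg.mul_left _)
  have hsum := hasSum_integral_iUnion hSm hdisj hI
  have hval : ∀ i, ∫ y in S i, f y ∂(haar p) =
      (((1 - (p : ℝ)⁻¹) * ((p : ℝ) ^ i * g i) : ℝ) : ℂ) := by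
    intro i
    rw [setIntegral_congr_fun (hSm i) (hfS i), setIntegral_const, hSreal, Complex.real_smul]
    push_cast
    ring
  simp only [hval] at hsum
  refine ⟨by rwa [IntegrableOn, hres] at hI, ?_⟩
  rw [hres] at hsum
  exact hsum.unique ((Complex.hasSum_ofReal).2 (hs.mul_left _))

end Haar

/-! ### Sums over spheres of the two power series -/

section Profile

/-- Fubini, with `n` running over powers and `l` over spheres. A summable majorant in `l` that is
uniform in `n` makes the double family absolutely summable, so summability of the coefficients is
the only convergence input. -/
theorem hasSum_tsum_mul {a : ℕ → ℝ} (ha : Summable a) {w : ℕ → ℕ → ℝ} {g W : ℕ → ℝ}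
    (hg : Summable g) (hw : ∀ l n, |w l n| ≤ g l) (hW : ∀ n, HasSum (fun l => w l n) (W n)) :
    HasSum (fun l => ∑' n, a n * w l n) (∑' n, a n * W n) ∧ Summable fun n => a n * W n := by
  have hF : Summable fun q : ℕ × ℕ => a q.1 * w q.2 q.1 := by
    refine Summable.of_norm_bounded (g := fun q : ℕ × ℕ => |a q.1| * g q.2)
      (ha.abs.mul_of_nonneg hg (fun _ => abs_nonneg _) fun l => (abs_nonneg _).trans (hw l 0)) ?_
    rintro ⟨n, l⟩
    rw [Real.norm_eq_abs, abs_mul]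
    exact mul_le_mul_of_nonneg_left (hw l n) (abs_nonneg _)
  have h1 : HasSum (fun n => a n * W n) (∑' q : ℕ × ℕ, a q.1 * w q.2 q.1) :=
    hF.hasSum.prod_fiberwise fun n => (hW n).mul_left (a n)
  have hF' : Summable fun q : ℕ × ℕ => a q.2 * w q.1 q.2 :=
    (Equiv.prodComm ℕ ℕ).summable_iff.1 hF
  have h2 : ∑' q : ℕ × ℕ, a q.2 * w q.1 q.2 = ∑' q : ℕ × ℕ, a q.1 * w q.2 q.1 :=
    ((Equiv.prodComm ℕ ℕ).tsum_eq fun q : ℕ × ℕ => a q.1 * w q.2 q.1)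
  refine ⟨?_, h1.summable⟩
  rw [h1.tsum_eq, ← h2]
  exact hF'.hasSum.prod_fiberwise fun l => (hF'.prod_factor l).hasSum

theorem hasSum_of_eq {f g : ℕ → ℝ} {a b : ℝ} (h : HasSum f a) (hf : ∀ n, g n = f n)
    (hab : b = a) : HasSum g b := by
  rwa [hab, funext hf]

/-- Separates the spheres off the unit ball (`i = n + 1`) from those inside; the unit sphere `i = 0`
belongs to the ball. -/
theorem hasSum_int_split {f : ℤ → ℝ} {a b : ℝ} (h₁ : HasSum (fun n : ℕ => f (n + 1)) a)
    (h₂ : HasSum (fun n : ℕ => f (-n)) b) : HasSum f (a + b) := by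
  rw [← (Equiv.addRight (1 : ℤ)).hasSum_iff]
  refine HasSum.of_nat_of_neg_add_one h₁ ?_
  convert h₂ using 2 with n
  simp

theorem summable_mul_of_abs_le {a w : ℕ → ℝ} {c : ℝ} (ha : Summable a) (hw : ∀ n, |w n| ≤ c) :
    Summable fun n => a n * w n := by
  refine Summable.of_norm_bounded (ha.abs.mul_right c) fun n => ?_
  rw [Real.norm_eq_abs, abs_mul]
  exact mul_le_mul_of_nonneg_left (hw n) (abs_nonneg _)

/-- The values on the spheres `|x|_p = p^i` of the radial function with coefficients `C` (on the
unit ball) and `b` (off the unit ball); `r = 1/p`. -/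
noncomputable def profile (r : ℝ) (C b : ℕ → ℝ) (i : ℤ) : ℝ :=
  if i ≤ 0 then ∑' m, C m * r ^ (2 * m * (-i).toNat)
  else ∑' m, b m * (r ^ 5 * r ^ ((i - 1).toNat * (2 * m + 5)))

variable {r : ℝ} {C b : ℕ → ℝ}

theorem profile_neg (t : ℕ) : profile r C b (-t) = ∑' m, C m * r ^ (2 * m * t) := by
  simp [profile]

theorem profile_add_one (s : ℕ) :
    profile r C b (s + 1) = ∑' m, b m * (r ^ 5 * r ^ (s * (2 * m + 5))) := by
  simp [profile, show ¬ ((s : ℤ) + 1 ≤ 0) by omega]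

theorem abs_pow_le_one (hr0 : 0 < r) (hr1 : r < 1) (n : ℕ) : |r ^ n| ≤ 1 := by
  rw [abs_of_pos (by positivity)]
  exact pow_le_one₀ hr0.le hr1.le

theorem abs_one_sub_pow_le (hr0 : 0 < r) (hr1 : r < 1) (n : ℕ) : |1 - r ^ n| ≤ 1 := by
  have h1 : 0 < r ^ n := by positivity
  have h2 : r ^ n ≤ 1 := pow_le_one₀ hr0.le hr1.le
  rw [abs_le]; constructor <;> linarith

theorem summable_inner (hC : Summable C) (hr0 : 0 < r) (hr1 : r < 1) (t : ℕ) :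
    Summable fun m => C m * r ^ (2 * m * t) :=
  summable_mul_of_abs_le hC fun _ => abs_pow_le_one hr0 hr1 _

theorem summable_outer (hb : Summable b) (hr0 : 0 < r) (hr1 : r < 1) (s : ℕ) :
    Summable fun m => b m * (r ^ 5 * r ^ (s * (2 * m + 5))) :=
  summable_mul_of_abs_le (c := 1) hb fun _ => by
    rw [← pow_add]; exact abs_pow_le_one hr0 hr1 _

theorem hasSum_geom (hr0 : 0 < r) (hr1 : r < 1) {k : ℕ} (hk : k ≠ 0) :
    HasSum (fun l : ℕ => r ^ (k * l)) (1 / (1 - r ^ k)) := by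
  have := hasSum_geometric_of_lt_one (r := r ^ k) (by positivity) (pow_lt_one₀ hr0.le hr1 hk)
  simpa only [← pow_mul, one_div] using this

/-- The contribution of a smaller sphere to the singular integral at a point of the unit ball. -/
theorem hasSum_inner_below (hC : Summable C) (hr0 : 0 < r) (hr1 : r < 1) (J : ℕ) :
    HasSum (fun l : ℕ => r ^ (l + 1) * (profile r C b (-J) - profile r C b (-(J + l + 1 : ℕ))))
      (∑' m, C m * (r ^ (2 * m * J) * (r / (1 - r) - r ^ (2 * m + 1) / (1 - r ^ (2 * m + 1))))) ∧
    Summable fun m =>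
      C m * (r ^ (2 * m * J) * (r / (1 - r) - r ^ (2 * m + 1) / (1 - r ^ (2 * m + 1)))) := by
  have h := hasSum_tsum_mul hC
    (w := fun l m => r ^ (2 * m * J) * (r ^ (l + 1) - r ^ ((2 * m + 1) * (l + 1))))
    (W := fun m => r ^ (2 * m * J) * (r / (1 - r) - r ^ (2 * m + 1) / (1 - r ^ (2 * m + 1))))
    (g := fun l => r ^ l) (summable_geometric_of_lt_one hr0.le hr1) ?_ ?_
  · refine ⟨hasSum_of_eq h.1 (fun l => ?_) rfl, h.2⟩
    rw [profile_neg, profile_neg, ← (summable_inner hC hr0 hr1 _).tsum_sub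
      (summable_inner hC hr0 hr1 _), ← tsum_mul_left]
    congr 1; ext m; ring
  · intro l m
    have e : r ^ (2 * m * J) * (r ^ (l + 1) - r ^ ((2 * m + 1) * (l + 1))) =
        r ^ l * (r ^ (2 * m * J + 1) * (1 - r ^ (2 * m * (l + 1)))) := by ring
    rw [e, abs_mul, abs_mul, abs_of_pos (by positivity : 0 < r ^ l)]
    have h1 := abs_pow_le_one hr0 hr1 (2 * m * J + 1)
    have h2 := abs_one_sub_pow_le hr0 hr1 (2 * m * (l + 1))
    have : 0 < r ^ l := by positivity
    calc _ ≤ r ^ l * (1 * 1) := by gcongr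
      _ = r ^ l := by ring
  · intro m
    refine HasSum.mul_left _ (HasSum.sub ?_ ?_)
    · have := (hasSum_geom hr0 hr1 one_ne_zero).mul_left r
      rw [pow_one] at this
      exact hasSum_of_eq this (fun _ => by ring) (by ring)
    · have := (hasSum_geom hr0 hr1 (k := 2 * m + 1) (by omega)).mul_left (r ^ (2 * m + 1))
      exact hasSum_of_eq this (fun _ => by ring) (by ring)

/-- The contribution of the complement of the unit ball at a point of the unit ball. -/
theorem hasSum_inner_above (hb : Summable b) (hr0 : 0 < r) (hr1 : r < 1) (F : ℝ) :
    HasSum (fun s : ℕ => r ^ (2 * (s + 1)) * (F - profile r C b (s + 1)))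
      (F * (r ^ 2 / (1 - r ^ 2)) - ∑' m, b m * (r ^ 7 / (1 - r ^ (2 * m + 7)))) := by
  have h := hasSum_tsum_mul hb
    (w := fun s m => r ^ 7 * r ^ ((2 * m + 7) * s))
    (W := fun m => r ^ 7 / (1 - r ^ (2 * m + 7)))
    (g := fun l => r ^ l) (summable_geometric_of_lt_one hr0.le hr1) ?_ ?_
  · have h2 := ((hasSum_geom hr0 hr1 two_ne_zero).mul_left (F * r ^ 2)).sub h.1
    refine hasSum_of_eq h2 (fun s => ?_) (by ring)
    rw [profile_add_one, mul_sub, ← tsum_mul_left]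
    congr 1
    · ring
    · congr 1; ext m; ring
  · intro s m
    have e : r ^ 7 * r ^ ((2 * m + 7) * s) = r ^ s * r ^ (7 + (2 * m + 6) * s) := by ring
    rw [e, abs_mul, abs_of_pos (by positivity : 0 < r ^ s)]
    exact mul_le_of_le_one_right (by positivity) (abs_pow_le_one hr0 hr1 _)
  · intro m
    have := (hasSum_geom hr0 hr1 (k := 2 * m + 7) (by omega)).mul_left (r ^ 7)
    rwa [mul_one_div] at this

/-- The contribution of the unit ball at a point outside. -/
theorem hasSum_outer_below (hC : Summable C) (hr0 : 0 < r) (hr1 : r < 1) (F : ℝ) :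
    HasSum (fun t : ℕ => r ^ t * (F - profile r C b (-t)))
      (F * (1 / (1 - r)) - ∑' m, C m * (1 / (1 - r ^ (2 * m + 1)))) := by
  have h := hasSum_tsum_mul hC
    (w := fun t m => r ^ ((2 * m + 1) * t))
    (W := fun m => 1 / (1 - r ^ (2 * m + 1)))
    (g := fun l => r ^ l) (summable_geometric_of_lt_one hr0.le hr1) ?_ ?_
  · have h2 := ((hasSum_geom hr0 hr1 one_ne_zero).mul_left F).sub h.1
    rw [pow_one] at h2
    refine hasSum_of_eq h2 (fun t => ?_) rfl
    rw [profile_neg, mul_sub, ← tsum_mul_left]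
    congr 1
    · ring
    · congr 1; ext m; ring
  · intro s m
    have e : r ^ ((2 * m + 1) * s) = r ^ s * r ^ (2 * m * s) := by ring
    rw [e, abs_mul, abs_of_pos (by positivity : 0 < r ^ s)]
    exact mul_le_of_le_one_right (by positivity) (abs_pow_le_one hr0 hr1 _)
  · intro m
    exact hasSum_geom hr0 hr1 (by omega)

/-- The contribution of the larger spheres at a point off the unit ball. -/
theorem hasSum_outer_above (hb : Summable b) (hr0 : 0 < r) (hr1 : r < 1) (k : ℕ) :
    HasSum (fun l : ℕ => r ^ (2 * (l + 1)) *
        (profile r C b (k + 1) - profile r C b ((k + l + 1 : ℕ) + 1)))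
      (∑' m, b m * (r ^ 5 * r ^ (k * (2 * m + 5)) *
        (r ^ 2 / (1 - r ^ 2) - r ^ (2 * m + 7) / (1 - r ^ (2 * m + 7))))) ∧
    Summable fun m => b m * (r ^ 5 * r ^ (k * (2 * m + 5)) *
        (r ^ 2 / (1 - r ^ 2) - r ^ (2 * m + 7) / (1 - r ^ (2 * m + 7)))) := by
  have h := hasSum_tsum_mul hb
    (w := fun l m => r ^ 5 * r ^ (k * (2 * m + 5)) *
      (r ^ (2 * (l + 1)) - r ^ ((2 * m + 7) * (l + 1))))
    (W := fun m => r ^ 5 * r ^ (k * (2 * m + 5)) *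
        (r ^ 2 / (1 - r ^ 2) - r ^ (2 * m + 7) / (1 - r ^ (2 * m + 7))))
    (g := fun l => r ^ l) (summable_geometric_of_lt_one hr0.le hr1) ?_ ?_
  · refine ⟨hasSum_of_eq h.1 (fun l => ?_) rfl, h.2⟩
    rw [profile_add_one, profile_add_one, ← (summable_outer hb hr0 hr1 _).tsum_sub
      (summable_outer hb hr0 hr1 _), ← tsum_mul_left]
    congr 1; ext m; ring
  · intro l m
    have e : r ^ 5 * r ^ (k * (2 * m + 5)) * (r ^ (2 * (l + 1)) - r ^ ((2 * m + 7) * (l + 1))) =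
        r ^ l * (r ^ (7 + l + k * (2 * m + 5)) * (1 - r ^ ((2 * m + 5) * (l + 1)))) := by ring
    rw [e, abs_mul, abs_mul, abs_of_pos (by positivity : 0 < r ^ l)]
    have h1 := abs_pow_le_one hr0 hr1 (7 + l + k * (2 * m + 5))
    have h2 := abs_one_sub_pow_le hr0 hr1 ((2 * m + 5) * (l + 1))
    have : 0 < r ^ l := by positivity
    calc _ ≤ r ^ l * (1 * 1) := by gcongr
      _ = r ^ l := by ring
  · intro m
    refine HasSum.mul_left _ (HasSum.sub ?_ ?_)
    · have := (hasSum_geom hr0 hr1 two_ne_zero).mul_left (r ^ 2)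
      exact hasSum_of_eq this (fun _ => by ring) (by ring)
    · have := (hasSum_geom hr0 hr1 (k := 2 * m + 7) (by omega)).mul_left (r ^ (2 * m + 7))
      exact hasSum_of_eq this (fun _ => by ring) (by ring)

end Profile

/-! ### The equation on each sphere and at the origin -/

section Equation

/-- The integral over the sphere `|y|_p = P^i` in `D²f(x)`, `|x|_p = P^j`, up to the factor
`1 - P⁻¹`. -/
noncomputable def sphereTerm (P : ℝ) (F : ℤ → ℝ) (j i : ℤ) : ℝ :=
  P ^ i * ((F j - F i) / max (P ^ i) (P ^ j) ^ 3)

theorem sphereTerm_of_le {P : ℝ} (hP : 2 ≤ P) (F : ℤ → ℝ) {j i : ℤ} (h : j ≤ i) :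
    sphereTerm P F j i = P ^ (-(2 * i)) * (F j - F i) := by
  have hP0 : P ≠ 0 := by positivity
  rw [sphereTerm, max_eq_left (zpow_le_zpow_right₀ (by linarith) h), zpow_neg, two_mul,
    zpow_add₀ hP0]
  field_simp

theorem sphereTerm_of_ge {P : ℝ} (hP : 2 ≤ P) (F : ℤ → ℝ) {j i : ℤ} (h : i ≤ j) :
    sphereTerm P F j i = P ^ (i - 3 * j) * (F j - F i) := by
  have hP0 : P ≠ 0 := by positivity
  rw [sphereTerm, max_eq_right (zpow_le_zpow_right₀ (by linarith) h), zpow_sub₀ hP0, mul_comm 3 j,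
    zpow_mul]
  norm_cast
  field_simp

/-- `(p² - 1) (1 - p⁻¹) / (1 - p⁻³)` in terms of `r = p⁻¹`. -/
noncomputable def scale (r : ℝ) : ℝ := (1 - r ^ 2) / (r ^ 2 * (1 + r + r ^ 2))

theorem scale_pos {r : ℝ} (hr0 : 0 < r) (hr1 : r < 1) : 0 < scale r := by
  have : 0 < 1 - r ^ 2 := by nlinarith
  unfold scale
  positivity

/-- Smaller and larger spheres contribute geometric series whose sum collapses to a product. The
parameter `w` is an even power of `r`, and the identity serves both regions: this is the reflection
`Γ_p(s) Γ_p(1 - s) = 1` at work. -/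
theorem scale_mul_symbol {r w : ℝ} (hr0 : 0 < r) (hr1 : r < 1) (hw0 : 0 < w) (hw1 : w < 1) :
    scale r * (r / (1 - r) - w * r ^ 3 / (1 - w * r ^ 3) + r ^ 2 / (1 - r ^ 2) + 1 / (1 - w)) =
      (r⁻¹) ^ 2 * ((1 - w * r) * (1 - w * r ^ 2) / ((1 - w) * (1 - w * r ^ 3))) := by
  have h1 : 1 - r ≠ 0 := by linarith
  have h2 : 1 - r ^ 2 ≠ 0 := by nlinarith
  have h3 : 1 - w ≠ 0 := by linarith
  have hr3 : r ^ 3 < 1 := pow_lt_one₀ hr0.le hr1 (by norm_num)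
  have h4 : 1 - w * r ^ 3 ≠ 0 := by nlinarith
  have h4' : 1 - r ^ 3 * w ≠ 0 := by rwa [mul_comm] at h4
  have h5 : 1 + r + r ^ 2 ≠ 0 := by positivity
  have h6 : 1 - r ^ 2 = (1 - r) * (1 + r) := by ring
  have h7 : 1 + r ≠ 0 := by positivity
  unfold scale
  rw [h6]
  field_simp
  ring

variable {P r E : ℝ} {C b : ℕ → ℝ}

theorem growthFactor_eq (hr : r = P⁻¹) (m : ℕ) :
    growthFactor P m = (1 - r ^ (2 * m) * r) * (1 - r ^ (2 * m) * r ^ 2) /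
      ((1 - r ^ (2 * m)) * (1 - r ^ (2 * m) * r ^ 3)) := by
  simp only [growthFactor, hr, inv_pow, pow_add, mul_inv, pow_one]

theorem inv_mem (hP : 2 ≤ P) (hr : r = P⁻¹) : 0 < r ∧ r < 1 := by
  rw [hr]
  exact ⟨by positivity, inv_lt_one_of_one_lt₀ (by linarith)⟩

/-- The eigenvalue of `|x|^{2m}` under `D²`, divided by `scale`. -/
theorem scale_mul_inner_symbol (hP : 2 ≤ P) (hr : r = P⁻¹) (m : ℕ) :
    scale r * (r / (1 - r) - r ^ (2 * (m + 2) + 1) / (1 - r ^ (2 * (m + 2) + 1)) +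
      r ^ 2 / (1 - r ^ 2) - 1 / (P ^ 2 * r ^ (2 * (m + 2)) - 1)) =
      P ^ 2 * growthFactor P (m + 1) := by
  obtain ⟨hr0, hr1⟩ := inv_mem hP hr
  have hPr : P = r⁻¹ := by rw [hr, inv_inv]
  have h := scale_mul_symbol hr0 hr1 (w := r ^ (2 * (m + 1))) (by positivity)
    (pow_lt_one₀ hr0.le hr1 (by omega))
  rw [← growthFactor_eq hr, ← hPr] at h
  rw [← h]
  have e1 : r ^ (2 * (m + 2) + 1) = r ^ (2 * (m + 1)) * r ^ 3 := by ring
  have e2 : P ^ 2 * r ^ (2 * (m + 2)) = r ^ (2 * (m + 1)) := by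
    rw [hPr]; field_simp; ring
  rw [e1, e2, ← neg_sub 1 (r ^ (2 * (m + 1))), div_neg, sub_neg_eq_add]

theorem scale_mul_outer_symbol (hP : 2 ≤ P) (hr : r = P⁻¹) (m : ℕ) :
    scale r * (r / (1 - r) + 1 / (1 - r ^ (2 * m + 4)) + r ^ 2 / (1 - r ^ 2) -
      r ^ (2 * m + 7) / (1 - r ^ (2 * m + 7))) = P ^ 2 * growthFactor P (m + 2) := by
  obtain ⟨hr0, hr1⟩ := inv_mem hP hr
  have hPr : P = r⁻¹ := by rw [hr, inv_inv]
  have h := scale_mul_symbol hr0 hr1 (w := r ^ (2 * (m + 2))) (by positivity)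
    (pow_lt_one₀ hr0.le hr1 (by omega))
  rw [← growthFactor_eq hr, ← hPr] at h
  rw [← h]
  have e1 : r ^ (2 * m + 7) = r ^ (2 * (m + 2)) * r ^ 3 := by ring
  have e2 : r ^ (2 * m + 4) = r ^ (2 * (m + 2)) := by ring
  rw [e1, e2]
  ring

theorem sq_mul_pow_ne_one (hP : 2 ≤ P) (hr : r = P⁻¹) {m : ℕ} (hm : m ≠ 1) :
    P ^ 2 * r ^ (2 * m) ≠ 1 := by
  obtain ⟨hr0, hr1⟩ := inv_mem hP hr
  have hP0 : P ≠ 0 := by positivity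
  intro h
  have h2 : r ^ (2 * m) = r ^ 2 := by
    rw [hr] at h ⊢
    field_simp at h ⊢
    exact h
  have := (pow_right_inj₀ hr0 hr1.ne).1 h2
  omega

/-- The weight `1 / (P^{2-2m} - 1)` of the inner energy condition. -/
theorem abs_inner_weight_le (hP : 2 ≤ P) (hr : r = P⁻¹) (m : ℕ) :
    |1 / (P ^ 2 * r ^ (2 * m) - 1)| ≤ 2 := by
  obtain ⟨hr0, hr1⟩ := inv_mem hP hr
  have hPr : P * r = 1 := by rw [hr]; field_simp
  match m with
  | 0 =>
    have : 0 < P ^ 2 - 1 := by nlinarith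
    simp only [mul_zero, pow_zero, mul_one]
    rw [abs_of_pos (by positivity), div_le_iff₀ this]
    nlinarith
  -- Here the denominator is zero and the weight takes the default value `0`; the corresponding
  -- coefficient is `c_2 = 0`.
  | 1 =>
    have : P ^ 2 * r ^ (2 * 1) = 1 := by rw [mul_one, ← mul_pow, hPr, one_pow]
    rw [this]; norm_num
  | m + 2 =>
    have h1 : P ^ 2 * r ^ (2 * (m + 2)) = r ^ (2 * m) * r ^ 2 := by
      calc _ = (P * r) ^ 2 * (r ^ (2 * m) * r ^ 2) := by ring
        _ = _ := by rw [hPr]; ring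
    have h2 : r ^ (2 * m) ≤ 1 := pow_le_one₀ hr0.le hr1.le
    have hr2 : r ≤ 1 / 2 := by
      rw [hr, one_div]; exact inv_anti₀ (by norm_num) hP
    have h3 : 0 < r ^ (2 * m) := by positivity
    have h4 : r ^ (2 * m) * r ^ 2 ≤ 1 / 4 := by
      have : r ^ 2 ≤ 1 / 4 := by nlinarith
      nlinarith [sq_nonneg r]
    rw [h1, abs_div, abs_one, abs_of_neg (by linarith), div_le_iff₀ (by linarith)]
    linarith

/-- With `|x| = P^(-J)` the factor `P^(2J) r^(2mJ)` is `|x|^(2m-2)`. The recursion turns the symbol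
times `C (m+2)` into `E C (m+1) - C m`, so summation gives `E ψ_0 - |x|² ψ_0` except for `E C 0`,
which no power supplies. -/
theorem IsInnerRec.hasSum_symbol (hP : 2 ≤ P) (hr : r = P⁻¹) (h : IsInnerRec P E C)
    (hC : Summable C) (J : ℕ) :
    HasSum (fun m => C m * (P ^ (2 * J) * r ^ (2 * m * J) *
        (r / (1 - r) - r ^ (2 * m + 1) / (1 - r ^ (2 * m + 1)) +
          r ^ 2 / (1 - r ^ 2) - 1 / (P ^ 2 * r ^ (2 * m) - 1))))
      ((scale r)⁻¹ * (E * (profile r C b (-J) - C 0) - r ^ (2 * J) * profile r C b (-J))) := by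
  obtain ⟨hr0, hr1⟩ := inv_mem hP hr
  have hPr : P * r = 1 := by rw [hr]; field_simp
  have hs := (scale_pos hr0 hr1).ne'
  have hF : HasSum (fun m => C m * r ^ (2 * m * J)) (profile r C b (-J)) := by
    rw [profile_neg]; exact (summable_inner hC hr0 hr1 J).hasSum
  have hF1 : HasSum (fun m => C (m + 1) * r ^ (2 * (m + 1) * J))
      (profile r C b (-J) - C 0) := by
    simpa using (hasSum_nat_add_iff' 1).2 hF
  have hF2 := ((hF1.mul_left E).sub (hF.mul_left (r ^ (2 * J)))).mul_left (scale r)⁻¹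
  -- `D²` annihilates constants: the symbol of `|x|^0` is zero.
  have hγ0 : r / (1 - r) - r ^ (2 * 0 + 1) / (1 - r ^ (2 * 0 + 1)) +
      r ^ 2 / (1 - r ^ 2) - 1 / (P ^ 2 * r ^ (2 * 0) - 1) = 0 := by
    have hP2 : P ^ 2 - 1 ≠ 0 := by nlinarith
    have hr2 : 1 - r ^ 2 ≠ 0 := by nlinarith
    have : r ^ 2 / (1 - r ^ 2) = 1 / (P ^ 2 - 1) := by
      rw [div_eq_div_iff hr2 hP2]
      have : r ^ 2 * P ^ 2 = 1 := by rw [← mul_pow, mul_comm, hPr, one_pow]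
      linarith
    simp [this]
  rw [← hasSum_nat_add_iff' 2, Finset.sum_range_succ, Finset.sum_range_one, hγ0, h.one]
  simp only [mul_zero, zero_mul, add_zero, sub_zero]
  refine hasSum_of_eq hF2 (fun m => ?_) rfl
  have h1 := scale_mul_inner_symbol hP hr m
  have h2 := h.step m
  have h3 : P ^ (2 * J) * r ^ (2 * (m + 2) * J) = r ^ (2 * (m + 1) * J) := by
    calc _ = (P * r) ^ (2 * J) * r ^ (2 * (m + 1) * J) := by rw [mul_pow]; ring
      _ = _ := by rw [hPr, one_pow, one_mul]
  have h4 : r ^ (2 * (m + 1) * J) = r ^ (2 * J) * r ^ (2 * m * J) := by ring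
  rw [h3, eq_inv_mul_iff_mul_eq₀ hs]
  calc _ = r ^ (2 * (m + 1) * J) * (C (m + 2) * (scale r * (r / (1 - r) -
        r ^ (2 * (m + 2) + 1) / (1 - r ^ (2 * (m + 2) + 1)) + r ^ 2 / (1 - r ^ 2) -
        1 / (P ^ 2 * r ^ (2 * (m + 2)) - 1)))) := by ring
    _ = r ^ (2 * (m + 1) * J) * (E * C (m + 1) - C m) := by rw [h1, ← h2]; ring
    _ = _ := by rw [mul_sub, h4]; ring

/-- The finite part of the singular integral on the unit ball. -/
theorem sum_inner_middle (hP : 2 ≤ P) (hr : r = P⁻¹) (hC1 : C 1 = 0) (hC : Summable C) (J : ℕ) :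
    HasSum (fun m => C m * (r ^ (2 * m * J) * ((P ^ (2 * J) - 1) * (r ^ 2 / (1 - r ^ 2))) -
        (P ^ (2 * J) * r ^ (2 * m * J) - 1) * (1 / (P ^ 2 * r ^ (2 * m) - 1))))
      (∑ t ∈ Finset.range J, P ^ (2 * t) * (profile r C b (-J) - profile r C b (-t))) := by
  obtain ⟨hr0, hr1⟩ := inv_mem hP hr
  have hPr : P * r = 1 := by rw [hr]; field_simp
  have h : ∀ t : ℕ, HasSum (fun m => C m * (P ^ (2 * t) * (r ^ (2 * m * J) - r ^ (2 * m * t))))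
      (P ^ (2 * t) * (profile r C b (-J) - profile r C b (-t))) := by
    intro t
    rw [profile_neg, profile_neg]
    refine hasSum_of_eq (((summable_inner hC hr0 hr1 J).hasSum.sub
      (summable_inner hC hr0 hr1 t).hasSum).mul_left (P ^ (2 * t))) (fun m => by ring) rfl
  refine hasSum_of_eq (hasSum_sum (s := Finset.range J) fun t _ => h t) (fun m => ?_) rfl
  -- For `m = 1` the geometric sum has ratio `1` and its closed form fails, but that coefficient
  -- vanishes.
  by_cases hm : m = 1
  · simp [hm, hC1]
  rw [← Finset.mul_sum]
  congr 1
  have hP2 : P ^ 2 - 1 ≠ 0 := by nlinarith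
  have hr2 : 1 - r ^ 2 ≠ 0 := by nlinarith
  have hPr2 : r ^ 2 * P ^ 2 = 1 := by rw [← mul_pow, mul_comm, hPr, one_pow]
  have e1 : r ^ 2 / (1 - r ^ 2) = 1 / (P ^ 2 - 1) := by
    rw [div_eq_div_iff hr2 hP2]
    linarith
  have hne := sq_mul_pow_ne_one hP hr hm
  have g1 : ∑ t ∈ Finset.range J, P ^ (2 * t) = (P ^ (2 * J) - 1) * (1 / (P ^ 2 - 1)) := by
    simp only [pow_mul]
    rw [geom_sum_eq (fun h => hP2 (by rw [h]; ring)), mul_one_div]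
  have g2 : ∑ t ∈ Finset.range J, P ^ (2 * t) * r ^ (2 * m * t) =
      (P ^ (2 * J) * r ^ (2 * m * J) - 1) * (1 / (P ^ 2 * r ^ (2 * m) - 1)) := by
    simp only [pow_mul, ← mul_pow]
    rw [← pow_mul r, geom_sum_eq hne, mul_one_div]
  rw [e1, ← g1, ← g2, Finset.mul_sum, ← Finset.sum_sub_distrib]
  exact Finset.sum_congr rfl fun t _ => by ring

/-- The symbol identity lacks `E C 0`. What is left over from the spheres `|x| < |y| ≤ 1` and from
outside the ball does not depend on `x`, and the inner energy condition says that it equals this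
missing term. -/
theorem hasSum_sphereTerm_inner (hP : 2 ≤ P) (hr : r = P⁻¹) (h : IsInnerRec P E C)
    (hC : Summable C) (hb : Summable b)
    (hE : scale r * (∑' m, C m * (1 / (P ^ 2 * r ^ (2 * m) - 1)) -
      ∑' m, b m * (r ^ 7 / (1 - r ^ (2 * m + 7)))) = E * C 0) (J : ℕ) :
    HasSum (sphereTerm P (profile r C b) (-J))
      ((scale r)⁻¹ * (E - r ^ (2 * J)) * profile r C b (-J)) := by
  obtain ⟨hr0, hr1⟩ := inv_mem hP hr
  have hP0 : P ≠ 0 := by positivity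
  have hs := (scale_pos hr0 hr1).ne'
  have hPr : ∀ n : ℤ, P ^ n = r ^ (-n) := fun n => by rw [hr]; simp
  set F := profile r C b (-J) with hFdef
  obtain ⟨hb1, hb2⟩ := hasSum_inner_below (b := b) hC hr0 hr1 J
  have hup : HasSum (fun n : ℕ => sphereTerm P (profile r C b) (-J) (n + 1)) _ :=
    hasSum_of_eq (hasSum_inner_above (C := C) hb hr0 hr1 F) (fun n => by
      rw [sphereTerm_of_le hP _ (by omega), hPr, ← hFdef]
      congr 1) rfl
  have hdown : HasSum (fun n : ℕ => sphereTerm P (profile r C b) (-J) (-n))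
      (P ^ (2 * J) * (∑' m, C m * (r ^ (2 * m * J) *
        (r / (1 - r) - r ^ (2 * m + 1) / (1 - r ^ (2 * m + 1))))) +
        ∑ t ∈ Finset.range J, P ^ (2 * t) * (F - profile r C b (-t))) := by
    have e : ∑ t ∈ Finset.range J, P ^ (2 * t) * (F - profile r C b (-t)) =
        ∑ t ∈ Finset.range (J + 1), sphereTerm P (profile r C b) (-J) (-t) := by
      rw [Finset.sum_range_succ, sphereTerm_of_le hP _ le_rfl, sub_self, mul_zero, add_zero]
      refine Finset.sum_congr rfl fun t ht => ?_
      have := Finset.mem_range.1 ht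
      rw [sphereTerm_of_le hP _ (by omega), ← hFdef]
      congr 1
      rw [← zpow_natCast]; congr 1; push_cast; ring
    rw [e, ← hasSum_nat_add_iff]
    refine hasSum_of_eq (hb1.mul_left (P ^ (2 * J))) (fun l => ?_) rfl
    rw [sphereTerm_of_ge hP _ (by omega), ← hFdef, ← mul_assoc]
    congr 1
    · rw [← zpow_natCast, hPr, hPr, ← zpow_natCast r, ← zpow_add₀ hr0.ne']
      congr 1; push_cast; ring
    · rw [show l + (J + 1) = J + l + 1 by ring]
  convert hasSum_int_split hup hdown using 1
  have hsym := h.hasSum_symbol (b := b) hP hr hC J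
  have hα : Summable fun m => C m * (1 / (P ^ 2 * r ^ (2 * m) - 1)) :=
    summable_mul_of_abs_le hC (abs_inner_weight_le hP hr)
  have hF : HasSum (fun m => C m * r ^ (2 * m * J)) F := by
    rw [hFdef, profile_neg]; exact (summable_inner hC hr0 hr1 J).hasSum
  have hmid := sum_inner_middle (b := b) hP hr h.one hC J
  have hL := (hF.mul_right (r ^ 2 / (1 - r ^ 2))).add
    ((hb2.hasSum.mul_left (P ^ (2 * J))).add hmid)
  have hR := hsym.add hα.hasSum
  -- Two expansions of the same coefficient series: by zones of spheres, and as symbol plus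
  -- constant.
  have key := hL.unique (hasSum_of_eq hR (fun m => by ring) rfl)
  have hE' : ∑' m, C m * (1 / (P ^ 2 * r ^ (2 * m) - 1)) -
      ∑' m, b m * (r ^ 7 / (1 - r ^ (2 * m + 7))) = (scale r)⁻¹ * (E * C 0) := by
    rw [← hE, inv_mul_cancel_left₀ hs]
  linear_combination -key - hE'

/-- At the origin the spheres carry weight `r^(-2t)`, so a term in `|y|^2` would not be summable.
Because `C 1 = 0`, the difference starts with `|y|^4` and the series converges. -/
theorem hasSum_zero_below (hr0 : 0 < r) (hr1 : r < 1) (hC1 : C 1 = 0) (hC : Summable C) :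
    HasSum (fun t : ℕ => r ^ (2 * (-t : ℤ)) * (C 0 - profile r C b (-t)))
      (-∑' m, C (m + 2) * (1 / (1 - r ^ (2 * m + 2)))) := by
  have hC2 : Summable fun m => C (m + 2) := (summable_nat_add_iff 2).2 hC
  have h := (hasSum_tsum_mul hC2 (w := fun t m => r ^ ((2 * m + 2) * t))
    (W := fun m => 1 / (1 - r ^ (2 * m + 2)))
    (g := fun l => r ^ l) (summable_geometric_of_lt_one hr0.le hr1) (fun l m => by
      have e : r ^ ((2 * m + 2) * l) = r ^ l * r ^ ((2 * m + 1) * l) := by ring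
      rw [e, abs_mul, abs_of_pos (by positivity : 0 < r ^ l)]
      exact mul_le_of_le_one_right (by positivity) (abs_pow_le_one hr0 hr1 _))
    (fun m => hasSum_geom hr0 hr1 (by omega))).1.neg
  refine hasSum_of_eq h (fun t => ?_) rfl
  have h1 := (hasSum_nat_add_iff' 2).2 (summable_inner hC hr0 hr1 t).hasSum
  rw [← profile_neg (b := b), Finset.sum_range_succ, Finset.sum_range_one, hC1, zero_mul,
    add_zero, mul_zero, zero_mul, pow_zero, mul_one] at h1
  rw [← neg_sub, mul_neg, ← h1.tsum_eq, ← tsum_mul_left]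
  congr 2
  ext m
  rw [mul_left_comm]
  congr 1
  rw [← zpow_natCast, ← zpow_natCast, ← zpow_add₀ hr0.ne']
  congr 1; push_cast; ring

/-- The equation at the origin. -/
theorem hasSum_sphereTerm_zero (hP : 2 ≤ P) (hr : r = P⁻¹) (hC1 : C 1 = 0)
    (hC : Summable C) (hb : Summable b)
    (hE : scale r * (∑' m, C m * (1 / (P ^ 2 * r ^ (2 * m) - 1)) -
      ∑' m, b m * (r ^ 7 / (1 - r ^ (2 * m + 7)))) = E * C 0) :
    HasSum (fun i : ℤ => r ^ (2 * i) * (C 0 - profile r C b i)) ((scale r)⁻¹ * (E * C 0)) := by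
  obtain ⟨hr0, hr1⟩ := inv_mem hP hr
  have hs := (scale_pos hr0 hr1).ne'
  have hPr1 : P * r = 1 := by rw [hr]; field_simp
  have hα : Summable fun m => C m * (1 / (P ^ 2 * r ^ (2 * m) - 1)) :=
    summable_mul_of_abs_le hC (abs_inner_weight_le hP hr)
  have hα2 := (hasSum_nat_add_iff' 2).2 hα.hasSum
  rw [Finset.sum_range_succ, Finset.sum_range_one, hC1, zero_mul, add_zero] at hα2
  have hshift : ∀ m : ℕ, P ^ 2 * r ^ (2 * (m + 2)) = r ^ (2 * m + 2) := by
    intro m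
    calc _ = (P * r) ^ 2 * r ^ (2 * m + 2) := by ring
      _ = _ := by rw [hPr1, one_pow, one_mul]
  have hneg := hasSum_of_eq (g := fun m => C (m + 2) * (1 / (1 - r ^ (2 * m + 2)))) hα2.neg
    (fun m => by rw [hshift, ← neg_sub 1 (r ^ (2 * m + 2)), div_neg, mul_neg, neg_neg]) rfl
  have hup : HasSum (fun s : ℕ => r ^ (2 * (s + 1 : ℤ)) * (C 0 - profile r C b (s + 1)))
      (C 0 * (r ^ 2 / (1 - r ^ 2)) - ∑' m, b m * (r ^ 7 / (1 - r ^ (2 * m + 7)))) :=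
    hasSum_of_eq (hasSum_inner_above (C := C) hb hr0 hr1 (C 0)) (fun s => by
      congr 1) rfl
  have htot := hasSum_int_split (f := fun i : ℤ => r ^ (2 * i) * (C 0 - profile r C b i)) hup
    (hasSum_zero_below hr0 hr1 hC1 hC)
  rw [hneg.tsum_eq] at htot
  have hP2 : P ^ 2 - 1 ≠ 0 := by nlinarith
  have hr2 : 1 - r ^ 2 ≠ 0 := by nlinarith
  have e : r ^ 2 / (1 - r ^ 2) = 1 / (P ^ 2 * r ^ (2 * 0) - 1) := by
    simp only [mul_zero, pow_zero, mul_one]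
    rw [div_eq_div_iff hr2 hP2]
    have : r ^ 2 * P ^ 2 = 1 := by rw [← mul_pow, mul_comm, hPr1, one_pow]
    linarith
  have hE' : ∑' m, C m * (1 / (P ^ 2 * r ^ (2 * m) - 1)) -
      ∑' m, b m * (r ^ 7 / (1 - r ^ (2 * m + 7))) = (scale r)⁻¹ * (E * C 0) := by
    rw [← hE, inv_mul_cancel_left₀ hs]
  rw [← hE']
  convert htot using 1
  rw [e]
  ring

/-- The symbol of `|x|^(-(2m+5))` lands on `|x|^(-(2m+7))`, where the recursion gives `E b (m+1) -
P² b (m+2)`. The shifted sums miss the first terms of `E ψ_0` and `|x|² ψ_0`. -/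
theorem IsOuterRec.hasSum_symbol (hP : 2 ≤ P) (hr : r = P⁻¹) (h : IsOuterRec P E b)
    (hb : Summable b) (k : ℕ) :
    HasSum (fun m => b m * (r ^ 5 * r ^ (k * (2 * m + 5)) * r ^ (2 * (k + 1)) *
        (r / (1 - r) + 1 / (1 - r ^ (2 * m + 4)) + r ^ 2 / (1 - r ^ 2) -
          r ^ (2 * m + 7) / (1 - r ^ (2 * m + 7)))))
      ((scale r)⁻¹ * ((E - P ^ (2 * (k + 1))) * profile r C b (k + 1) +
        r ^ (3 * (k + 1)) * b 0)) := by
  obtain ⟨hr0, hr1⟩ := inv_mem hP hr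
  have hPr : P * r = 1 := by rw [hr]; field_simp
  have hs := (scale_pos hr0 hr1).ne'
  have hF : HasSum (fun m => b m * (r ^ 5 * r ^ (k * (2 * m + 5)))) (profile r C b (k + 1)) := by
    rw [profile_add_one]; exact (summable_outer hb hr0 hr1 k).hasSum
  have hF1 := (hasSum_nat_add_iff' 1).2 hF
  have hF2 := (hasSum_nat_add_iff' 2).2 hF
  rw [Finset.sum_range_one] at hF1
  rw [Finset.sum_range_succ, Finset.sum_range_one] at hF2
  have hPk : P ^ (2 * k) * r ^ (2 * k) = 1 := by rw [← mul_pow, hPr, one_pow]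
  have hsum := ((hF1.mul_left E).sub (hF2.mul_left (P ^ (2 * (k + 1))))).mul_left (scale r)⁻¹
  refine hasSum_of_eq hsum (fun m => ?_) ?_
  · have h1 := scale_mul_outer_symbol hP hr m
    have h2 := h.step m
    rw [eq_inv_mul_iff_mul_eq₀ hs]
    have e1 : r ^ (k * (2 * (m + 1) + 5)) = r ^ (k * (2 * m + 5)) * r ^ (2 * k) := by ring
    have e2 : P ^ (2 * (k + 1)) * r ^ (k * (2 * (m + 2) + 5)) =
        P ^ 2 * (r ^ (k * (2 * m + 5)) * r ^ (2 * k)) := by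
      calc _ = P ^ 2 * (P ^ (2 * k) * r ^ (2 * k)) * (r ^ (k * (2 * m + 5)) * r ^ (2 * k)) := by
            ring
        _ = _ := by rw [hPk, mul_one]
    have e3 : r ^ (2 * (k + 1)) * P ^ 2 = r ^ (2 * k) := by
      calc _ = (P * r) ^ 2 * r ^ (2 * k) := by ring
        _ = _ := by rw [hPr, one_pow, one_mul]
    calc _ = b m * (r ^ 5 * r ^ (k * (2 * m + 5)) * r ^ (2 * (k + 1)) * (scale r *
          (r / (1 - r) + 1 / (1 - r ^ (2 * m + 4)) + r ^ 2 / (1 - r ^ 2) -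
          r ^ (2 * m + 7) / (1 - r ^ (2 * m + 7))))) := by ring
      _ = b m * (r ^ 5 * r ^ (k * (2 * m + 5)) * (r ^ (2 * (k + 1)) * P ^ 2) *
          growthFactor P (m + 2)) := by rw [h1]; ring
      _ = r ^ 5 * r ^ (k * (2 * m + 5)) * r ^ (2 * k) * (E * b (m + 1) - P ^ 2 * b (m + 2)) := by
        rw [h2, e3]; ring
      _ = E * (b (m + 1) * (r ^ 5 * r ^ (k * (2 * (m + 1) + 5)))) -
          b (m + 2) * r ^ 5 * (P ^ (2 * (k + 1)) * r ^ (k * (2 * (m + 2) + 5))) := by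
        rw [e1, e2]; ring
      _ = _ := by ring
  -- Among the missing terms, those with `E b 0` and `P² b 1` cancel by the initial relation
  -- `h.one`; only `|x|^(-3) b 0` remains.
  · have e1 : P ^ (2 * (k + 1)) * r ^ (k * (2 * (0 + 1) + 5)) = P ^ 2 * r ^ (5 * k) := by
      calc _ = P ^ 2 * (P ^ (2 * k) * r ^ (2 * k)) * r ^ (5 * k) := by ring
        _ = _ := by rw [hPk, mul_one]
    have e2 : P ^ (2 * (k + 1)) * (r ^ 5 * r ^ (k * (2 * 0 + 5))) = r ^ (3 * (k + 1)) := by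
      calc _ = (P * r) ^ 2 * (P ^ (2 * k) * r ^ (2 * k)) * r ^ (3 * (k + 1)) := by ring
        _ = _ := by rw [hPk, hPr]; ring
    have e3 : r ^ (k * (2 * 0 + 5)) = r ^ (5 * k) := by ring
    have h1 := h.one
    simp only [zero_add] at *
    linear_combination (scale r)⁻¹ * (-b 0 * e2 - b 1 * r ^ 5 * e1 + E * b 0 * r ^ 5 * e3 -
      r ^ 5 * r ^ (5 * k) * h1)

/-- The finite part of the singular integral off the unit ball. -/
theorem sum_outer_middle (hP : 2 ≤ P) (hr : r = P⁻¹) (hb : Summable b) (k : ℕ) :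
    HasSum (fun m => b m * (r ^ 5 * (r ^ (k * (2 * m + 5)) * ((P ^ k - 1) * (1 / (1 - r))) +
        P * ((r ^ (k * (2 * m + 4)) - 1) * (1 / (1 - r ^ (2 * m + 4)))))))
      (∑ s ∈ Finset.range k, P ^ (s + 1) * (profile r C b (k + 1) - profile r C b (s + 1))) := by
  obtain ⟨hr0, hr1⟩ := inv_mem hP hr
  have hPr : P * r = 1 := by rw [hr]; field_simp
  have h : ∀ t : ℕ, HasSum (fun m => b m * (r ^ 5 * (P ^ (t + 1) *
      (r ^ (k * (2 * m + 5)) - r ^ (t * (2 * m + 5))))))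
      (P ^ (t + 1) * (profile r C b (k + 1) - profile r C b (t + 1))) := by
    intro t
    rw [profile_add_one, profile_add_one]
    refine hasSum_of_eq (((summable_outer hb hr0 hr1 k).hasSum.sub
      (summable_outer hb hr0 hr1 t).hasSum).mul_left (P ^ (t + 1))) (fun m => by ring) rfl
  refine hasSum_of_eq (hasSum_sum (s := Finset.range k) fun t _ => h t) (fun m => ?_) rfl
  rw [← Finset.mul_sum, ← Finset.mul_sum]
  congr 2
  have hP1 : P - 1 ≠ 0 := by linarith
  have hr2 : 1 - r ≠ 0 := by linarith
  have hm1 : r ^ (2 * m + 4) < 1 := pow_lt_one₀ hr0.le hr1 (by omega)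
  have g1 : ∑ t ∈ Finset.range k, P ^ (t + 1) = (P ^ k - 1) * (1 / (1 - r)) := by
    simp only [pow_succ]
    rw [← Finset.sum_mul, geom_sum_eq (fun h => hP1 (by rw [h]; ring))]
    field_simp
    linear_combination (P ^ k - 1) * -hPr
  have g2 : ∑ t ∈ Finset.range k, P ^ (t + 1) * r ^ (t * (2 * m + 5)) =
      -(P * ((r ^ (k * (2 * m + 4)) - 1) * (1 / (1 - r ^ (2 * m + 4))))) := by
    have : ∀ t : ℕ, P ^ (t + 1) * r ^ (t * (2 * m + 5)) = P * (r ^ (2 * m + 4)) ^ t := by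
      intro t
      calc _ = P * ((P * r) ^ t * (r ^ (2 * m + 4)) ^ t) := by rw [mul_pow]; ring
        _ = _ := by rw [hPr, one_pow, one_mul]
    simp only [this]
    rw [← Finset.mul_sum, geom_sum_eq hm1.ne, ← pow_mul, mul_comm (2 * m + 4) k,
      ← neg_sub 1 (r ^ (2 * m + 4)), div_neg]
    ring
  rw [← g1, ← neg_eq_iff_eq_neg.2 g2, ← sub_eq_add_neg, Finset.mul_sum, ← Finset.sum_sub_distrib]
  exact Finset.sum_congr rfl fun t _ => by ring

/-- Outside the ball every leftover is a multiple of `|x|^(-3)`: the end terms of the spheres `1 <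
|y| < |x|`, the whole unit ball, and the `b 0` from the symbol identity. The outer energy condition
is the vanishing of their total. -/
theorem hasSum_sphereTerm_outer (hP : 2 ≤ P) (hr : r = P⁻¹) (h : IsOuterRec P E b)
    (hC : Summable C) (hb : Summable b)
    (hE : scale r * (∑' m, b m * (r ^ 4 / (1 - r ^ (2 * m + 4))) +
      ∑' m, C m * (1 / (1 - r ^ (2 * m + 1)))) = b 0) (k : ℕ) :
    HasSum (sphereTerm P (profile r C b) (k + 1))
      ((scale r)⁻¹ * (E - P ^ (2 * (k + 1))) * profile r C b (k + 1)) := by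
  obtain ⟨hr0, hr1⟩ := inv_mem hP hr
  have hP0 : P ≠ 0 := by positivity
  have hs := (scale_pos hr0 hr1).ne'
  have hPr1 : P * r = 1 := by rw [hr]; field_simp
  have hPr : ∀ n : ℤ, P ^ n = r ^ (-n) := fun n => by rw [hr]; simp
  set F := profile r C b (k + 1) with hFdef
  obtain ⟨hb1, hb2⟩ := hasSum_outer_above (C := C) hb hr0 hr1 k
  have hdown : HasSum (fun n : ℕ => sphereTerm P (profile r C b) (k + 1) (-n)) _ :=
    hasSum_of_eq ((hasSum_outer_below (b := b) hC hr0 hr1 F).mul_left (r ^ (3 * (k + 1))))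
      (fun n => by
      rw [sphereTerm_of_ge hP _ (by omega), hPr, ← hFdef, ← mul_assoc]
      congr 1
      rw [← zpow_natCast, ← zpow_natCast, ← zpow_add₀ hr0.ne']; congr 1; push_cast; ring) rfl
  have hup : HasSum (fun n : ℕ => sphereTerm P (profile r C b) (k + 1) (n + 1))
      (r ^ (2 * (k + 1)) * (∑' m, b m * (r ^ 5 * r ^ (k * (2 * m + 5)) *
        (r ^ 2 / (1 - r ^ 2) - r ^ (2 * m + 7) / (1 - r ^ (2 * m + 7))))) +
        r ^ (3 * (k + 1)) *
        ∑ s ∈ Finset.range k, P ^ (s + 1) * (F - profile r C b (s + 1))) := by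
    have e : r ^ (3 * (k + 1)) * ∑ s ∈ Finset.range k, P ^ (s + 1) * (F - profile r C b (s + 1)) =
        ∑ s ∈ Finset.range (k + 1), sphereTerm P (profile r C b) (k + 1) (s + 1) := by
      rw [Finset.sum_range_succ, sphereTerm_of_le hP _ le_rfl, sub_self, mul_zero, add_zero,
        Finset.mul_sum]
      refine Finset.sum_congr rfl fun s hs => ?_
      have := Finset.mem_range.1 hs
      rw [sphereTerm_of_ge hP _ (by omega), ← hFdef, ← mul_assoc]
      congr 1
      rw [← zpow_natCast P, hPr, hPr, ← zpow_natCast, ← zpow_add₀ hr0.ne']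
      congr 1; push_cast; ring
    rw [e, ← hasSum_nat_add_iff]
    refine hasSum_of_eq (hb1.mul_left (r ^ (2 * (k + 1)))) (fun l => ?_) rfl
    rw [sphereTerm_of_le hP _ (by push_cast; omega), ← hFdef, ← mul_assoc]
    congr 1
    · rw [← zpow_natCast, hPr, ← zpow_natCast r, ← zpow_add₀ hr0.ne']
      congr 1; push_cast; ring
    · congr 3; push_cast; ring
  convert hasSum_int_split hup hdown using 1
  have hsym := h.hasSum_symbol (C := C) hP hr hb k
  have hα : Summable fun m => b m * (r ^ 4 / (1 - r ^ (2 * m + 4))) := by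
    refine summable_mul_of_abs_le (c := r ^ 4 / (1 - r)) hb fun m => ?_
    have h1 : r ^ (2 * m + 4) ≤ r := pow_le_of_le_one hr0.le hr1.le (by omega)
    rw [abs_of_pos (div_pos (by positivity) (by linarith))]
    exact div_le_div_of_nonneg_left (by positivity) (by linarith) (by linarith)
  have hF : HasSum (fun m => b m * (r ^ 5 * r ^ (k * (2 * m + 5)))) F := by
    rw [hFdef, profile_add_one]; exact (summable_outer hb hr0 hr1 k).hasSum
  have hmid := sum_outer_middle (C := C) hP hr hb k
  have hL := (hF.mul_right (r ^ (3 * (k + 1)) * (1 / (1 - r)))).add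
    ((hb2.hasSum.mul_left (r ^ (2 * (k + 1)))).add (hmid.mul_left (r ^ (3 * (k + 1)))))
  have hR := hsym.sub (hα.hasSum.mul_left (r ^ (3 * (k + 1))))
  have key := hL.unique (hasSum_of_eq hR (fun m => by
    have e1 : r ^ (3 * (k + 1)) * (r ^ (k * (2 * m + 5)) * P ^ k) =
        r ^ (2 * (k + 1)) * r ^ (k * (2 * m + 5)) * r := by
      calc _ = r ^ (2 * (k + 1)) * r ^ (k * (2 * m + 5)) * r * (P * r) ^ k := by
            rw [mul_pow]; ring
        _ = _ := by rw [hPr1, one_pow, mul_one]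
    have e2 : r ^ (3 * (k + 1)) * P * r ^ (k * (2 * m + 4)) =
        r ^ (2 * (k + 1)) * r ^ (k * (2 * m + 5)) := by
      calc _ = r ^ (2 * (k + 1)) * r ^ (k * (2 * m + 5)) * (P * r) := by ring
        _ = _ := by rw [hPr1, mul_one]
    have e3 : r ^ 5 * P = r ^ 4 := by
      calc _ = r ^ 4 * (P * r) := by ring
        _ = _ := by rw [hPr1, mul_one]
    linear_combination b m * r ^ 5 * (1 / (1 - r)) * e1 +
      b m * r ^ 5 * (1 / (1 - r ^ (2 * m + 4))) * e2 -
      b m * r ^ (3 * (k + 1)) * (1 / (1 - r ^ (2 * m + 4))) * e3) rfl)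
  have hE' : ∑' m, b m * (r ^ 4 / (1 - r ^ (2 * m + 4))) +
      ∑' m, C m * (1 / (1 - r ^ (2 * m + 1))) = (scale r)⁻¹ * b 0 := by
    rw [← hE, inv_mul_cancel_left₀ hs]
  linear_combination -key + r ^ (3 * (k + 1)) * hE'

end Equation

/-! ### From the original coefficients to the normalised ones -/

theorem Gam_natCast_add_one (p n : ℕ) :
    Gam p ((n : ℝ) + 1) = (1 - (p : ℝ) ^ n) / (1 - ((p : ℝ) ^ (n + 1))⁻¹) := by
  have hp0 : (0 : ℝ) ≤ p := by positivity
  rw [Gam, add_sub_cancel_right, Real.rpow_natCast, Real.rpow_neg hp0, ← Nat.cast_succ,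
    Real.rpow_natCast]

theorem Gam_neg_natCast (p n : ℕ) :
    Gam p (-(n : ℝ)) = (1 - ((p : ℝ) ^ (n + 1))⁻¹) / (1 - (p : ℝ) ^ n) := by
  have hp0 : (0 : ℝ) ≤ p := by positivity
  rw [Gam, neg_neg, Real.rpow_natCast, ← neg_add', Real.rpow_neg hp0, ← Nat.cast_succ,
    Real.rpow_natCast]

theorem support_even {f : ℕ → ℝ} (hf : ∀ n, f (2 * n + 1) = 0) :
    Function.support f ⊆ Set.range fun m : ℕ => 2 * m := by
  intro n hn
  rcases Nat.even_or_odd' n with ⟨m, rfl | rfl⟩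
  · exact ⟨m, rfl⟩
  · exact absurd (hf m) hn

theorem IsCoeff.support_c {p : ℕ} {E : ℝ} {c k : ℕ → ℝ} (h : IsCoeff p 1 E c k) (w : ℕ → ℝ) :
    Function.support (fun n => c n * w n) ⊆ Set.range fun m : ℕ => 2 * m :=
  support_even fun n => by rw [h.c_odd, zero_mul]

theorem IsCoeff.support_k {p : ℕ} {E : ℝ} {c k : ℕ → ℝ} (h : IsCoeff p 1 E c k) (w : ℕ → ℝ) :
    Function.support (fun n => k (n + 1) * w n) ⊆ Set.range fun m : ℕ => 2 * m + 4 := by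
  intro n hn
  have hk : k (n + 1) ≠ 0 := left_ne_zero_of_mul hn
  rcases Nat.even_or_odd' n with ⟨m, rfl | rfl⟩
  · match m with
    | 0 => exact absurd h.k_one hk
    | 1 => exact absurd h.k_three hk
    | m + 2 => exact ⟨m, by ring⟩
  · exact absurd (h.k_even (m + 1) (by omega)) hk

theorem injective_two_mul_add (a : ℕ) : Function.Injective fun m : ℕ => 2 * m + a :=
  fun m n hmn => by simp only at hmn; omega

theorem IsCoeff.tsum_c {p : ℕ} {E : ℝ} {c k : ℕ → ℝ} (h : IsCoeff p 1 E c k) (w : ℕ → ℝ) :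
    ∑' n, c n * w n = ∑' m, c (2 * m) * w (2 * m) :=
  ((injective_two_mul_add 0).tsum_eq (h.support_c w)).symm

theorem IsCoeff.tsum_k {p : ℕ} {E : ℝ} {c k : ℕ → ℝ} (h : IsCoeff p 1 E c k) (w : ℕ → ℝ) :
    ∑' n, k (n + 1) * w n = ∑' m, k (2 * m + 5) * w (2 * m + 4) :=
  ((injective_two_mul_add 4).tsum_eq (h.support_k w)).symm

theorem IsCoeff.summable_c {p : ℕ} {E : ℝ} {c k : ℕ → ℝ} (h : IsCoeff p 1 E c k) {w : ℕ → ℝ}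
    (hs : Summable fun m => c (2 * m) * w (2 * m)) : Summable fun n => c n * w n := by
  refine ((injective_two_mul_add 0).summable_iff fun n hn => ?_).1 hs
  by_contra hne
  exact hn (h.support_c w hne)

theorem IsCoeff.summable_k {p : ℕ} {E : ℝ} {c k : ℕ → ℝ} (h : IsCoeff p 1 E c k) {w : ℕ → ℝ}
    (hs : Summable fun m => k (2 * m + 5) * w (2 * m + 4)) :
    Summable fun n => k (n + 1) * w n := by
  refine ((injective_two_mul_add 4).summable_iff fun n hn => ?_).1 hs
  by_contra hne
  exact hn (h.support_k w hne)

section Coefficients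

variable {p : ℕ} [hp : Fact p.Prime] {E : ℝ} {c k : ℕ → ℝ}

theorem one_sub_pow_eq {P : ℝ} (hP : 2 ≤ P) (n : ℕ) : 1 - P ^ n = -(P ^ n * (1 - (P ^ n)⁻¹)) := by
  have : P ^ n ≠ 0 := by positivity
  field_simp
  ring

theorem Gam_ratio_pos (n : ℕ) :
    Gam p (2 * n + 5) / Gam p (2 * n + 3) = (p : ℝ) ^ 2 * growthFactor p (n + 1) := by
  have hP := two_le_prime p
  rw [show (2 * n + 5 : ℝ) = ((2 * n + 4 : ℕ) : ℝ) + 1 by push_cast; ring, Gam_natCast_add_one,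
    show (2 * n + 3 : ℝ) = ((2 * n + 2 : ℕ) : ℝ) + 1 by push_cast; ring, Gam_natCast_add_one,
    one_sub_pow_eq hP, one_sub_pow_eq hP, growthFactor]
  have e : ∀ m, m ≠ 0 → 1 - ((p : ℝ) ^ m)⁻¹ ≠ 0 := fun m hm => (one_sub_inv_pow_pos hP hm).ne'
  have e2 := e (2 * n + 2) (by omega)
  have e3 := e (2 * n + 2 + 1) (by omega)
  have e4 := e (2 * n + 4) (by omega)
  have e5 := e (2 * n + 4 + 1) (by omega)
  have hp0 : (p : ℝ) ≠ 0 := by positivity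
  simp only [show 2 * (n + 1) = 2 * n + 2 by ring, show 2 * n + 2 + 3 = 2 * n + 4 + 1 by ring,
    show 2 * n + 2 + 2 = 2 * n + 4 by ring]
  have hpow : (p : ℝ) ^ (2 * n + 4) = p ^ 2 * p ^ (2 * n + 2) := by ring
  generalize 1 - ((p : ℝ) ^ (2 * n + 2))⁻¹ = X2 at *
  generalize 1 - ((p : ℝ) ^ (2 * n + 2 + 1))⁻¹ = X3 at *
  generalize 1 - ((p : ℝ) ^ (2 * n + 4))⁻¹ = X4 at *
  generalize 1 - ((p : ℝ) ^ (2 * n + 4 + 1))⁻¹ = X5 at *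
  rw [hpow]
  have : (p : ℝ) ^ (2 * n + 2) ≠ 0 := by positivity
  generalize (p : ℝ) ^ (2 * n + 2) = Y at *
  field_simp

/-- By the reflection `Γ_p(s) Γ_p(1 - s) = 1` this ratio equals `Γ_p(2n+3)/Γ_p(2n+1)`, so the
correction factor is the same as on the unit ball. -/
theorem Gam_ratio_neg {n : ℕ} (hn : 1 ≤ n) :
    Gam p (-2 * n) / Gam p (-2 * n - 2) = (p : ℝ) ^ 2 * growthFactor p n := by
  have hP := two_le_prime p
  rw [show (-2 * n - 2 : ℝ) = -((2 * n + 2 : ℕ) : ℝ) by push_cast; ring, Gam_neg_natCast,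
    show (-2 * n : ℝ) = -((2 * n : ℕ) : ℝ) by push_cast; ring, Gam_neg_natCast,
    one_sub_pow_eq hP, one_sub_pow_eq hP, growthFactor]
  have e : ∀ m, m ≠ 0 → 1 - ((p : ℝ) ^ m)⁻¹ ≠ 0 := fun m hm => (one_sub_inv_pow_pos hP hm).ne'
  have e2 := e (2 * n) (by omega)
  have e3 := e (2 * n + 1) (by omega)
  have e4 := e (2 * n + 2) (by omega)
  have e5 := e (2 * n + 3) (by omega)
  have hp0 : (p : ℝ) ≠ 0 := by positivity
  simp only [show 2 * n + 2 + 1 = 2 * n + 3 by ring]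
  have hpow : (p : ℝ) ^ (2 * n + 2) = p ^ 2 * p ^ (2 * n) := by ring
  generalize 1 - ((p : ℝ) ^ (2 * n))⁻¹ = X2 at *
  generalize 1 - ((p : ℝ) ^ (2 * n + 1))⁻¹ = X3 at *
  generalize 1 - ((p : ℝ) ^ (2 * n + 2))⁻¹ = X4 at *
  generalize 1 - ((p : ℝ) ^ (2 * n + 3))⁻¹ = X5 at *
  rw [hpow]
  have : (p : ℝ) ^ (2 * n) ≠ 0 := by positivity
  generalize (p : ℝ) ^ (2 * n) = Y at *
  field_simp

theorem IsCoeff.isInnerRec (h : IsCoeff p 1 E c k) : IsInnerRec p E fun m => c (2 * m) where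
  one := h.c_two
  step m := by
    have := h.c_rec m
    rw [Gam_ratio_pos] at this
    rw [show 2 * (m + 2) = 2 * m + 4 by ring, show 2 * (m + 1) = 2 * m + 2 by ring]
    linarith

/-- The scaling by `p^(-2m)` gives the recursion the same limit polynomial as on the ball. It also
makes summability equivalent to absolute convergence on `|x| = p`, the sphere nearest to the ball
and hence the worst one. The initial relation is the case `n = 1` of the recursion with `k_3 = 0`.
-/
theorem IsCoeff.isOuterRec (h : IsCoeff p 1 E c k) :
    IsOuterRec p E fun m => k (2 * m + 5) * ((p : ℝ)⁻¹) ^ (2 * m) where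
  one := by
    have hp0 : (p : ℝ) ≠ 0 := by exact_mod_cast hp.out.ne_zero
    have := h.k_rec 1 le_rfl
    norm_num [h.k_three] at this
    simp only [mul_one, mul_zero, pow_zero, zero_add]
    field_simp
    exact this
  step m := by
    have hp0 : (p : ℝ) ≠ 0 := by exact_mod_cast hp.out.ne_zero
    have h1 := h.k_rec (m + 2) (by omega)
    rw [Gam_ratio_neg (by omega)] at h1
    rw [show 2 * (m + 2) + 1 = 2 * m + 5 by ring, show 2 * (m + 2) + 5 = 2 * m + 9 by ring,
      show 2 * (m + 2) + 3 = 2 * m + 7 by ring] at h1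
    have e : (p : ℝ) ^ 2 * ((p : ℝ)⁻¹) ^ (2 * m + 2) = ((p : ℝ)⁻¹) ^ (2 * m) := by
      rw [pow_add]; field_simp
    have e4 : (p : ℝ) ^ 2 * ((p : ℝ)⁻¹) ^ (2 * m + 4) = ((p : ℝ)⁻¹) ^ (2 * m + 2) := by
      rw [show 2 * m + 4 = 2 * m + 2 + 2 by ring, pow_add _ (2 * m + 2)]; field_simp
    simp only [show 2 * (m + 2) = 2 * m + 4 by ring, show 2 * (m + 1) = 2 * m + 2 by ring]
    linear_combination ((p : ℝ)⁻¹) ^ (2 * m + 2) * h1 + k (2 * m + 9) * e4 -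
      k (2 * m + 5) * growthFactor p (m + 2) * e

theorem scale_eq :
    scale (p : ℝ)⁻¹ = ((p : ℝ) ^ 2 - 1) / (1 - ((p : ℝ)⁻¹) ^ 3) * (1 - (p : ℝ)⁻¹) := by
  obtain ⟨hr0, hr1⟩ := inv_mem (two_le_prime p) rfl
  have hp0 : (p : ℝ) ≠ 0 := by exact_mod_cast hp.out.ne_zero
  have hpr : (p : ℝ) = ((p : ℝ)⁻¹)⁻¹ := (inv_inv _).symm
  have key : ∀ r : ℝ, 0 < r → r < 1 →
      scale r = (r⁻¹ ^ 2 - 1) / (1 - r ^ 3) * (1 - r) := by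
    intro r hr0 hr1
    have h3 : 1 - r ^ 3 ≠ 0 := by
      have := pow_lt_one₀ hr0.le hr1 (n := 3) (by norm_num)
      linarith
    have h4 : 1 + r + r ^ 2 ≠ 0 := by positivity
    rw [scale, div_mul_eq_mul_div, div_eq_div_iff (by positivity) h3]
    field_simp
    ring
  rw [key _ hr0 hr1, inv_inv]

/-- The factor `1/Γ_p(-2)` is, up to sign, the normalising constant of `D²`, and `(p-1)/p` is the
measure of the unit sphere. The identity also holds at `X = 0`, both sides being `0` by default, so
the excluded term with `c_2` needs no separate treatment. -/
theorem inv_Gam_mul (X : ℝ) : 1 / Gam p (-2) * (((p : ℝ) - 1) / (-(p * X))) =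
    scale (p : ℝ)⁻¹ * (1 / X) := by
  have hp0 : (p : ℝ) ≠ 0 := by exact_mod_cast hp.out.ne_zero
  have hP := two_le_prime p
  have h1 := (one_sub_inv_pow_pos hP (n := 3) (by norm_num)).ne'
  have h2 : 1 - (p : ℝ) ^ 2 ≠ 0 := by nlinarith
  have h3 : Gam p (-2) = (1 - ((p : ℝ) ^ 3)⁻¹) / (1 - (p : ℝ) ^ 2) := by
    have := Gam_neg_natCast p 2
    norm_num at this ⊢
    exact this
  rw [h3, scale_eq, inv_pow]
  generalize 1 - ((p : ℝ) ^ 3)⁻¹ = Y at *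
  rw [one_div_div, ← neg_sub ((p : ℝ) ^ 2) 1, div_neg, mul_neg, neg_div, neg_mul, neg_neg,
    div_mul_eq_div_div]
  have : ((p : ℝ) - 1) / p = 1 - (p : ℝ)⁻¹ := by field_simp
  rw [this]
  ring

/-- The energy conditions in terms of the rescaled coefficients. -/
theorem IsCoeff.energyCondition_iff (h : IsCoeff p 1 E c k) :
    EnergyCondition p 1 E c k ↔
      scale (p : ℝ)⁻¹ * (∑' m, c (2 * m) * (1 / ((p : ℝ) ^ 2 * ((p : ℝ)⁻¹) ^ (2 * m) - 1)) -
        ∑' m, k (2 * m + 5) * ((p : ℝ)⁻¹) ^ (2 * m) *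
          (((p : ℝ)⁻¹) ^ 7 / (1 - ((p : ℝ)⁻¹) ^ (2 * m + 7)))) = E * c 0 ∧
      scale (p : ℝ)⁻¹ * (∑' m, k (2 * m + 5) * ((p : ℝ)⁻¹) ^ (2 * m) *
          (((p : ℝ)⁻¹) ^ 4 / (1 - ((p : ℝ)⁻¹) ^ (2 * m + 4))) +
        ∑' m, c (2 * m) * (1 / (1 - ((p : ℝ)⁻¹) ^ (2 * m + 1)))) = k 5 := by
  have hp0 : (p : ℝ) ≠ 0 := by exact_mod_cast hp.out.ne_zero
  have s1 : ∑' n : ℕ, c n * (1 / Gam p (-2)) *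
      (((p : ℝ) - 1) / ((p : ℝ) - (p : ℝ) ^ (3 - (n : ℤ)))) = scale (p : ℝ)⁻¹ *
      ∑' m, c (2 * m) * (1 / ((p : ℝ) ^ 2 * ((p : ℝ)⁻¹) ^ (2 * m) - 1)) := by
    simp only [mul_assoc]
    rw [h.tsum_c, ← tsum_mul_left]
    congr 1; ext m
    rw [mul_left_comm (scale _), ← inv_Gam_mul]
    congr 4
    rw [zpow_sub₀ hp0, zpow_natCast, inv_pow]
    norm_cast
    field_simp
    push_cast
    ring
  have s2 : ∑' n : ℕ, k (n + 1) * (1 / Gam p (-2)) *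
      ((1 - (p : ℝ)) / ((p : ℝ) - (p : ℝ) ^ ((n + 1) + 3))) = -(scale (p : ℝ)⁻¹ *
      ∑' m, k (2 * m + 5) * ((p : ℝ)⁻¹) ^ (2 * m) *
          (((p : ℝ)⁻¹) ^ 7 / (1 - ((p : ℝ)⁻¹) ^ (2 * m + 7)))) := by
    simp only [mul_assoc]
    rw [h.tsum_k fun n => 1 / Gam p (-2) * ((1 - (p : ℝ)) / ((p : ℝ) - (p : ℝ) ^ ((n + 1) + 3))),
      ← tsum_mul_left, ← tsum_neg]
    congr 1; ext m
    have := inv_Gam_mul (p := p) ((p : ℝ) ^ (2 * m + 7) - 1)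
    rw [← neg_sub (p : ℝ) 1, neg_div, mul_neg, mul_neg,
      show (p : ℝ) - p ^ (2 * m + 4 + 1 + 3) = -(p * (p ^ (2 * m + 7) - 1)) by ring, this]
    have e : 1 / ((p : ℝ) ^ (2 * m + 7) - 1) = ((p : ℝ)⁻¹) ^ (2 * m) *
          (((p : ℝ)⁻¹) ^ 7 / (1 - ((p : ℝ)⁻¹) ^ (2 * m + 7))) := by
      rw [← mul_div_assoc, ← pow_add, inv_pow]
      field_simp
    rw [e]
    ring
  have s3 : ∑' n : ℕ, k (n + 1) * (1 / Gam p (-2)) *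
          (((p : ℝ) - 1) / ((p : ℝ) - (p : ℝ) ^ (n + 1))) = scale (p : ℝ)⁻¹ *
      ∑' m, k (2 * m + 5) * ((p : ℝ)⁻¹) ^ (2 * m) *
          (((p : ℝ)⁻¹) ^ 4 / (1 - ((p : ℝ)⁻¹) ^ (2 * m + 4))) := by
    simp only [mul_assoc]
    rw [h.tsum_k fun n => 1 / Gam p (-2) * (((p : ℝ) - 1) / ((p : ℝ) - (p : ℝ) ^ (n + 1))),
      ← tsum_mul_left]
    congr 1; ext m
    have := inv_Gam_mul (p := p) ((p : ℝ) ^ (2 * m + 4) - 1)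
    rw [show (p : ℝ) - p ^ (2 * m + 4 + 1) = -(p * (p ^ (2 * m + 4) - 1)) by ring, this]
    have e : 1 / ((p : ℝ) ^ (2 * m + 4) - 1) = ((p : ℝ)⁻¹) ^ (2 * m) *
          (((p : ℝ)⁻¹) ^ 4 / (1 - ((p : ℝ)⁻¹) ^ (2 * m + 4))) := by
      rw [← mul_div_assoc, ← pow_add, inv_pow]
      field_simp
    rw [e]
    ring
  have s4 : ∑' n : ℕ, c n * (1 / Gam p (-2)) *
      (((p : ℝ) - 1) / ((p : ℝ) - (p : ℝ) ^ (-(n : ℤ)))) = -(scale (p : ℝ)⁻¹ *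
      ∑' m, c (2 * m) * (1 / (1 - ((p : ℝ)⁻¹) ^ (2 * m + 1)))) := by
    simp only [mul_assoc]
    rw [h.tsum_c, ← tsum_mul_left, ← tsum_neg]
    congr 1; ext m
    have e : (p : ℝ) - (p : ℝ) ^ (-((2 * m : ℕ) : ℤ)) =
        -(p * (((p : ℝ)⁻¹) ^ (2 * m + 1) - 1)) := by
      rw [zpow_neg, zpow_natCast, pow_succ, inv_pow]
      field_simp
      ring
    rw [e, inv_Gam_mul, ← neg_sub 1, one_div_neg_eq_neg_one_div]
    ring
  constructor
  · rintro ⟨h1, h2⟩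
    rw [s1, s2] at h1
    rw [s3, s4] at h2
    constructor <;> linarith
  · rintro ⟨h1, h2⟩
    constructor
    · rw [s1, s2]; linarith
    · rw [s3, s4]; linarith

end Coefficients

/-- The even coefficients on the unit ball. -/
abbrev innerCoeff (c : ℕ → ℝ) : ℕ → ℝ := fun m => c (2 * m)

/-- The rescaled odd coefficients off the unit ball. -/
noncomputable abbrev outerCoeff (p : ℕ) (k : ℕ → ℝ) : ℕ → ℝ :=
  fun m => k (2 * m + 5) * ((p : ℝ)⁻¹) ^ (2 * m)

theorem outer_term_eq (p : ℕ) (k : ℕ → ℝ) (s m : ℕ) :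
    k (2 * m + 5) * (((p : ℝ) ^ (s + 1 : ℤ)) ^ (2 * m + 5))⁻¹ =
      outerCoeff p k m * (((p : ℝ)⁻¹) ^ 5 * ((p : ℝ)⁻¹) ^ (s * (2 * m + 5))) := by
  rw [outerCoeff, mul_assoc]
  congr 1
  rw [← inv_pow, ← inv_zpow]
  norm_cast
  ring

/-! ### Convergence and the equation under the energy conditions -/

section Solution

variable {p : ℕ} [hp : Fact p.Prime] {E : ℝ} {c k : ℕ → ℝ}

theorem exists_norm_eq_zpow {x : ℚ_[p]} (hx : x ≠ 0) : ∃ i : ℤ, ‖x‖ = (p : ℝ) ^ i :=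
  ⟨_, Padic.norm_eq_zpow_neg_valuation hx⟩

theorem norm_eq_of_not_le_one {x : ℚ_[p]} (h : ¬ ‖x‖ ≤ 1) :
    ∃ s : ℕ, ‖x‖ = (p : ℝ) ^ (s + 1 : ℤ) := by
  have hx : x ≠ 0 := by rintro rfl; simp at h
  obtain ⟨i, hi⟩ := exists_norm_eq_zpow hx
  rw [hi, ← zpow_zero (p : ℝ), zpow_le_zpow_iff_right₀ (by exact_mod_cast hp.out.one_lt)] at h
  exact ⟨(i - 1).toNat, by rw [hi]; congr 1; omega⟩

theorem IsCoeff.convergesEverywhere (h : IsCoeff p 1 E c k) (hC : Summable (innerCoeff c))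
    (hb : Summable (outerCoeff p k)) : ConvergesEverywhere p c k := by
  obtain ⟨hr0, hr1⟩ := inv_mem (two_le_prime p) rfl
  constructor
  · intro x hx
    refine h.summable_c (summable_mul_of_abs_le hC (c := 1) fun n => ?_)
    rw [abs_of_nonneg (by positivity)]
    exact pow_le_one₀ (norm_nonneg _) hx
  · intro x hx
    obtain ⟨s, hs⟩ := norm_eq_of_not_le_one hx
    refine h.summable_k (w := fun n => (‖x‖ ^ (n + 1))⁻¹)
      ((summable_outer hb hr0 hr1 s).congr fun m => ?_)
    rw [hs, outer_term_eq]

theorem psi_zero : psi p c k 0 = (c 0 : ℂ) := by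
  rw [psi, if_pos (by simp), norm_zero, tsum_eq_single 0]
  · simp
  · intro n hn
    simp [hn]

theorem psi_of_norm_eq (h : IsCoeff p 1 E c k) {x : ℚ_[p]} {i : ℤ} (hx : ‖x‖ = (p : ℝ) ^ i) :
    psi p c k x = (profile (p : ℝ)⁻¹ (innerCoeff c) (outerCoeff p k) i : ℂ) := by
  have hp1 : (1 : ℝ) < p := by exact_mod_cast hp.out.one_lt
  have hiff : ‖x‖ ≤ 1 ↔ i ≤ 0 := by
    rw [hx, ← zpow_zero (p : ℝ), zpow_le_zpow_iff_right₀ hp1]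
  rw [psi]
  rcases le_or_gt i 0 with hi | hi
  · rw [if_pos (hiff.2 hi)]
    obtain ⟨t, rfl⟩ : ∃ t : ℕ, i = -t := ⟨(-i).toNat, by omega⟩
    rw [profile_neg, h.tsum_c, hx]
    congr 2; ext m
    congr 1
    rw [zpow_neg, zpow_natCast, ← inv_pow]
    ring
  · rw [if_neg (by rw [hiff]; omega)]
    obtain ⟨s, rfl⟩ : ∃ s : ℕ, i = s + 1 := ⟨(i - 1).toNat, by omega⟩
    rw [profile_add_one, h.tsum_k (fun n => (‖x‖ ^ (n + 1))⁻¹), hx]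
    congr 2; ext m
    exact outer_term_eq p k s m

theorem norm_sub_eq_max {x y : ℚ_[p]} (h : ‖x‖ ≠ ‖y‖) : ‖x - y‖ = max ‖y‖ ‖x‖ := by
  rw [sub_eq_add_neg, Padic.add_eq_max_of_ne (by rwa [norm_neg]), norm_neg, max_comm]

/-- `scale` collects the constant of `D²` and the factor `1 - p⁻¹` from the measure of spheres, so a
sphere sum `scale⁻¹ T` means `D² f (x) = T`. -/
theorem D_two_eq {f : ℚ_[p] → ℂ} {x : ℚ_[p]} {g : ℤ → ℝ} {T : ℝ}
    (hf : ∀ y i, ‖y‖ = (p : ℝ) ^ i → derivIntegrand p 2 f x y = g i)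
    (hs : HasSum (fun i => (p : ℝ) ^ i * g i) ((scale (p : ℝ)⁻¹)⁻¹ * T)) :
    Integrable (derivIntegrand p 2 f x) (haar p) ∧ D p 2 f x = (T : ℂ) := by
  obtain ⟨hr0, hr1⟩ := inv_mem (two_le_prime p) rfl
  obtain ⟨h1, h2⟩ := radial_integral p hf hs.summable.abs hs
  refine ⟨h1, ?_⟩
  rw [D, h2, ← Complex.ofReal_mul]
  congr 1
  have e : ((p : ℝ) ^ (2 : ℝ) - 1) / (1 - (p : ℝ) ^ (-2 - 1 : ℝ)) =
      ((p : ℝ) ^ 2 - 1) / (1 - ((p : ℝ)⁻¹) ^ 3) := by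
    rw [show (-2 - 1 : ℝ) = -((3 : ℕ) : ℝ) by norm_num, Real.rpow_neg (by positivity),
      Real.rpow_natCast, inv_pow, Real.rpow_two]
  rw [e, ← mul_assoc, ← scale_eq, mul_inv_cancel_left₀ (scale_pos hr0 hr1).ne']

theorem IsCoeff.isSolution (h : IsCoeff p 1 E c k) (hC : Summable (innerCoeff c))
    (hb : Summable (outerCoeff p k)) (hE : EnergyCondition p 1 E c k) :
    IsSolution p 1 E (psi p c k) := by
  have hP := two_le_prime p
  obtain ⟨hE1, hE2⟩ := h.energyCondition_iff.1 hE
  have hi := h.isInnerRec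
  have ho := h.isOuterRec
  intro x
  by_cases hx : x = 0
  · subst hx
    have hs := hasSum_sphereTerm_zero hP rfl hi.one hC hb hE1
    obtain ⟨h1, h2⟩ := D_two_eq (f := psi p c k) (x := 0) (T := E * c 0)
      (g := fun i => (c 0 - profile (p : ℝ)⁻¹ (innerCoeff c) (outerCoeff p k) i) /
        ((p : ℝ) ^ i) ^ 3)
      (fun y i hy => by
        rw [derivIntegrand, psi_zero, psi_of_norm_eq h hy, zero_sub, norm_neg, hy,
          show (2 + 1 : ℝ) = ((3 : ℕ) : ℝ) by norm_num, Real.rpow_natCast]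
        push_cast
        rfl)
      (by
        convert hs using 2 with i
        have hp0 : (p : ℝ) ≠ 0 := by positivity
        rw [two_mul, inv_zpow, zpow_add₀ hp0]
        field_simp)
    refine ⟨h1, ?_⟩
    rw [h2, psi_zero]
    simp
  · obtain ⟨j, hj⟩ := exists_norm_eq_zpow hx
    set F := profile (p : ℝ)⁻¹ (innerCoeff c) (outerCoeff p k) with hF
    have hs : HasSum (sphereTerm p F j) ((scale (p : ℝ)⁻¹)⁻¹ * ((E - ‖x‖ ^ 2) * F j)) := by
      rw [← mul_assoc]
      rcases le_or_gt j 0 with hj0 | hj0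
      · obtain ⟨t, rfl⟩ : ∃ t : ℕ, j = -t := ⟨(-j).toNat, by omega⟩
        have := hasSum_sphereTerm_inner hP rfl hi hC hb hE1 t
        convert this using 4
        rw [hj, zpow_neg, zpow_natCast, ← inv_pow]
        ring
      · obtain ⟨s, rfl⟩ : ∃ s : ℕ, j = s + 1 := ⟨(j - 1).toNat, by omega⟩
        have := hasSum_sphereTerm_outer hP rfl ho hC hb (hE2.trans (by simp)) s
        convert this using 4
        rw [hj]
        norm_cast
        ring
    obtain ⟨h1, h2⟩ := D_two_eq (f := psi p c k) (x := x)
      (g := fun i => (F j - F i) / max ((p : ℝ) ^ i) ((p : ℝ) ^ j) ^ 3)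
      (fun y i hy => by
        rw [derivIntegrand, psi_of_norm_eq h hj, psi_of_norm_eq h hy, ← hF]
        -- On the sphere through `x` the numerator vanishes, so the varying distance `|x - y|` plays
        -- no role.
        by_cases hij : i = j
        · subst hij; simp
        · have hne : ‖x‖ ≠ ‖y‖ := by
            rw [hj, hy]
            exact fun h' => hij (zpow_right_injective₀ (by positivity)
              (by exact_mod_cast hp.out.one_lt.ne') h').symm
          rw [norm_sub_eq_max hne, hj, hy,
            show (2 + 1 : ℝ) = ((3 : ℕ) : ℝ) by norm_num, Real.rpow_natCast]
          push_cast
          rfl) hs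
    refine ⟨h1, ?_⟩
    rw [h2, psi_of_norm_eq h hj, ← hF]
    push_cast
    ring

theorem eq_zero_of_rec {u α β : ℕ → ℝ} (hu : ∀ m, u (m + 2) = α m * u (m + 1) - β m * u m)
    (h0 : u 0 = 0) (h1 : u 1 = 0) : u = 0 := by
  have : ∀ m, u m = 0 ∧ u (m + 1) = 0 := by
    intro m
    induction m with
    | zero => exact ⟨h0, h1⟩
    | succ m ih => exact ⟨ih.2, by rw [hu, ih.1, ih.2]; ring⟩
  exact funext fun m => (this m).1

theorem IsInnerRec.eq_zero {P E : ℝ} {u : ℕ → ℝ} (hP : 2 ≤ P) (h : IsInnerRec P E u)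
    (h0 : u 0 = 0) : u = 0 :=
  eq_zero_of_rec (h.step' hP) h0 h.one

theorem IsOuterRec.eq_zero {P E : ℝ} {u : ℕ → ℝ} (hP : 2 ≤ P) (h : IsOuterRec P E u)
    (h0 : u 0 = 0) : u = 0 := by
  refine eq_zero_of_rec (h.step' hP) h0 ?_
  have h1 := h.one
  rw [h0, mul_zero] at h1
  exact (mul_eq_zero.1 h1).resolve_left (by positivity)

/-- Weights with bounded inverse cannot make a divergent series converge, so the weighted sum takes
its default value `0`. The inverse `v` is only required where `a` does not vanish. -/
theorem tsum_mul_eq_zero_of_not_summable {a w v : ℕ → ℝ} {C : ℝ} (ha : ¬ Summable a)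
    (hv : ∀ n, a n * w n * v n = a n) (hC : ∀ n, |v n| ≤ C) : ∑' n, a n * w n = 0 :=
  tsum_eq_zero_of_not_summable fun hs =>
    ha ((summable_mul_of_abs_le hs hC).congr hv)

/-- If one of the two series diverges, the energy conditions fail unless both free coefficients
vanish. -/
theorem IsCoeff.summable_of_energyCondition (h : IsCoeff p 1 E c k)
    (hE : EnergyCondition p 1 E c k) : Summable (innerCoeff c) ∧ Summable (outerCoeff p k) := by
  have hP := two_le_prime p
  obtain ⟨hr0, hr1⟩ := inv_mem hP rfl
  have hi := h.isInnerRec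
  have ho := h.isOuterRec
  rcases lt_or_ge |E| ((p : ℝ) ^ 2 + 1) with hlt | hge
  · exact ⟨hi.summable hP hlt, ho.summable hP hlt⟩
  obtain ⟨hE1, hE2⟩ := h.energyCondition_iff.1 hE
  have hE0 : E ≠ 0 := by
    rintro rfl
    rw [abs_zero] at hge
    nlinarith
  have hpr : (p : ℝ) * (p : ℝ)⁻¹ = 1 := mul_inv_cancel₀ (by positivity)
  -- Either `k_5 = 0` and every term vanishes, or the series diverges; in both cases the `k`-sums
  -- drop out of the energy conditions.
  have hk : ∀ j n : ℕ, ∑' m, outerCoeff p k m *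
      (((p : ℝ)⁻¹) ^ j / (1 - ((p : ℝ)⁻¹) ^ (2 * m + (n + 1)))) = 0 := by
    intro j n
    by_cases h5 : k 5 = 0
    · have h0 : outerCoeff p k = 0 :=
        ho.eq_zero hP (by simp [h5])
      exact (tsum_congr fun m => by rw [h0, Pi.zero_apply, zero_mul]).trans tsum_zero
    · refine tsum_mul_eq_zero_of_not_summable
        (v := fun m => (1 - ((p : ℝ)⁻¹) ^ (2 * m + (n + 1))) / ((p : ℝ)⁻¹) ^ j)
        (C := 1 / ((p : ℝ)⁻¹) ^ j)
        (ho.not_summable hP hge (by simpa using h5)) (fun m => ?_) fun m => ?_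
      · have : 1 - ((p : ℝ)⁻¹) ^ (2 * m + (n + 1)) ≠ 0 := by
          have := pow_lt_one₀ hr0.le hr1 (n := 2 * m + (n + 1)) (by omega)
          linarith
        have : ((p : ℝ)⁻¹) ^ j ≠ 0 := by positivity
        rw [mul_assoc, div_mul_div_cancel₀ (by assumption), div_self this, mul_one]
      · rw [abs_div, abs_of_pos (by positivity : 0 < ((p : ℝ)⁻¹) ^ j)]
        gcongr
        exact abs_one_sub_pow_le hr0 hr1 _
  rw [hk 7 6] at hE1
  rw [hk 4 3] at hE2
  have hc0 : c 0 = 0 := by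
    by_contra hc
    have := tsum_mul_eq_zero_of_not_summable (a := innerCoeff c)
      (w := fun m => 1 / ((p : ℝ) ^ 2 * ((p : ℝ)⁻¹) ^ (2 * m) - 1))
      (v := fun m => (p : ℝ) ^ 2 * ((p : ℝ)⁻¹) ^ (2 * m) - 1) (C := (p : ℝ) ^ 2 + 1)
      (hi.not_summable hP hge hc) (fun m => ?_) fun m => ?_
    · rw [this, sub_zero, mul_zero] at hE1
      exact mul_ne_zero hE0 hc hE1.symm
    -- The weight is not invertible at `m = 1`, where the coefficient is `c_2 = 0`.
    · rcases eq_or_ne ((p : ℝ) ^ 2 * ((p : ℝ)⁻¹) ^ (2 * m) - 1) 0 with h0 | h0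
      · obtain rfl : m = 1 := by
          by_contra hm
          exact sq_mul_pow_ne_one hP rfl hm (sub_eq_zero.1 h0)
        simp [h.c_two]
      · rw [mul_assoc, one_div, inv_mul_cancel₀ h0, mul_one]
    · have h1 : ((p : ℝ)⁻¹) ^ (2 * m) ≤ 1 := pow_le_one₀ hr0.le hr1.le
      have h2 : 0 < ((p : ℝ)⁻¹) ^ (2 * m) := by positivity
      rw [abs_le]
      constructor <;> nlinarith
  have hC : innerCoeff c = 0 := hi.eq_zero hP hc0
  have hC' : ∀ m, c (2 * m) = 0 := fun m => congrFun hC m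
  have hk5 : k 5 = 0 := by simpa [hC'] using hE2.symm
  have hb : outerCoeff p k = 0 := ho.eq_zero hP (by simp [hk5])
  exact ⟨by rw [hC]; exact summable_zero, by rw [hb]; exact summable_zero⟩

end Solution

/-! ### The 2×2 system for `(c_0, k_5)` and estimates of its entries -/

section Existence

/-- The coefficients on the unit ball with `c 0 = 1`. -/
noncomputable def innerSol (P E : ℝ) : ℕ → ℝ
  | 0 => 1
  | 1 => 0
  | m + 2 => (E * innerSol P E (m + 1) - innerSol P E m) / (P ^ 2 * growthFactor P (m + 1))

/-- The rescaled coefficients off the unit ball with `k 5 = 1`. -/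
noncomputable def outerSol (P E : ℝ) : ℕ → ℝ
  | 0 => 1
  | 1 => E / P ^ 2
  | m + 2 => (E * outerSol P E (m + 1) - growthFactor P (m + 2) * outerSol P E m) / P ^ 2

variable {P E : ℝ}

theorem isInnerRec_innerSol (hP : 2 ≤ P) : IsInnerRec P E (innerSol P E) where
  one := by rw [innerSol]
  step m := by
    have := growthFactor_pos hP (m := m + 1) (by omega)
    rw [innerSol]
    field_simp

theorem isOuterRec_outerSol (hP : 2 ≤ P) : IsOuterRec P E (outerSol P E) where
  one := by
    rw [outerSol, outerSol]
    field_simp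
  step m := by
    rw [outerSol]
    field_simp

theorem continuous_innerSol (P : ℝ) (m : ℕ) : Continuous fun E => innerSol P E m := by
  induction m using Nat.strong_induction_on with
  | _ m ih =>
    match m with
    | 0 => simp only [innerSol]; fun_prop
    | 1 => simp only [innerSol]; fun_prop
    | m + 2 =>
      have h1 := ih m (by omega)
      have h2 := ih (m + 1) (by omega)
      simp only [innerSol]
      fun_prop

theorem continuous_outerSol (P : ℝ) (m : ℕ) : Continuous fun E => outerSol P E m := by
  induction m using Nat.strong_induction_on with
  | _ m ih =>
    match m with
    | 0 => simp only [outerSol]; fun_prop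
    | 1 => simp only [outerSol]; fun_prop
    | m + 2 =>
      have h1 := ih m (by omega)
      have h2 := ih (m + 1) (by omega)
      simp only [outerSol]
      fun_prop

theorem growthFactor_le {m : ℕ} (hP : 2 ≤ P) (hm : 2 ≤ m) : growthFactor P m ≤ 9 / 8 := by
  have h1 := (growthFactor_bounds hP (m := m) (by omega)).2
  have : (1 / 4 : ℝ) ^ m ≤ (1 / 4) ^ 2 := pow_le_pow_of_le_one (by norm_num) (by norm_num) hm
  norm_num at this
  linarith

theorem abs_inner_coeff_le {e : ℝ} (hP : 2 ≤ P) (hE : |E| ≤ e) {m : ℕ} (hm : 1 ≤ m) :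
    |E / (P ^ 2 * growthFactor P m)| ≤ e * (P⁻¹) ^ 2 ∧
      |1 / (P ^ 2 * growthFactor P m)| ≤ (P⁻¹) ^ 2 := by
  have hg := (growthFactor_bounds hP hm).1
  have hP2 : 0 < P ^ 2 := by positivity
  have h1 : P ^ 2 ≤ P ^ 2 * growthFactor P m := by nlinarith
  rw [abs_div, abs_div, abs_one, abs_of_pos (hP2.trans_le h1), inv_pow, ← div_eq_mul_inv,
    ← one_div]
  have : 0 ≤ e := (abs_nonneg _).trans hE
  constructor <;> gcongr

theorem abs_outer_coeff_le {e : ℝ} (hP : 2 ≤ P) (hE : |E| ≤ e) :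
    |E / P ^ 2| ≤ e * (P⁻¹) ^ 2 ∧
      ∀ m, |growthFactor P (m + 2) / P ^ 2| ≤ 9 / 8 * (P⁻¹) ^ 2 := by
  have hP2 : 0 < P ^ 2 := by positivity
  constructor
  · rw [abs_div, abs_of_pos hP2, inv_pow, ← div_eq_mul_inv]
    gcongr
  · intro m
    rw [abs_div, abs_of_pos hP2, abs_of_pos (growthFactor_pos hP (by omega)), inv_pow,
      ← div_eq_mul_inv]
    have := growthFactor_le hP (m := m + 2) (by omega)
    gcongr

theorem inv_sq_le (hP : 2 ≤ P) : (P⁻¹) ^ 2 ≤ 1 / 4 := by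
  have : P⁻¹ ≤ 2⁻¹ := inv_anti₀ (by norm_num) hP
  have : 0 ≤ P⁻¹ := by positivity
  nlinarith

theorem abs_innerSol_le (hP : 2 ≤ P) (hE : |E| ≤ 5 / 2) (m : ℕ) :
    |innerSol P E m| ≤ (19 / 20) ^ m := by
  have hr := inv_sq_le hP
  -- Using `P⁻² ≤ 1/4`: `5/8` is `5/2 · 1/4` and `9/32` is `9/8 · 1/4`, and `θ = 19/20` satisfies
  -- `5/8 θ + 9/32 ≤ θ²`. The value `9/32` is dictated by the outer recursion and shared here.
  refine abs_le_pow_of_rec (a := 5 / 8) (b := 9 / 32) (by norm_num) (by norm_num) (by norm_num)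
    (by norm_num) ((isInnerRec_innerSol hP).step' hP) (fun m => ?_) (fun m => ?_) ?_ ?_ m
  · have := (abs_inner_coeff_le hP hE (m := m + 1) (by omega)).1
    linarith
  · have := (abs_inner_coeff_le hP hE (m := m + 1) (by omega)).2
    linarith
  · simp [innerSol]
  · norm_num [innerSol]

theorem abs_outerSol_le (hP : 2 ≤ P) (hE : |E| ≤ 5 / 2) (m : ℕ) :
    |outerSol P E m| ≤ (19 / 20) ^ m := by
  have hr := inv_sq_le hP
  obtain ⟨h1, h2⟩ := abs_outer_coeff_le hP hE
  refine abs_le_pow_of_rec (a := 5 / 8) (b := 9 / 32) (by norm_num) (by norm_num) (by norm_num)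
    (by norm_num) ((isOuterRec_outerSol hP).step' hP) (fun m => ?_) (fun m => ?_) ?_ ?_ m
  · linarith
  · have := h2 m
    linarith
  · simp [outerSol]
  · rw [outerSol]
    linarith

theorem summable_innerSol (hP : 2 ≤ P) (hE : |E| ≤ 5 / 2) : Summable (innerSol P E) :=
  Summable.of_norm_bounded (summable_geometric_of_lt_one (r := 19 / 20) (by norm_num)
    (by norm_num)) fun m => abs_innerSol_le hP hE m

theorem summable_outerSol (hP : 2 ≤ P) (hE : |E| ≤ 5 / 2) : Summable (outerSol P E) :=
  Summable.of_norm_bounded (summable_geometric_of_lt_one (r := 19 / 20) (by norm_num)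
    (by norm_num)) fun m => abs_outerSol_le hP hE m

theorem continuousOn_tsum_mul {u : ℝ → ℕ → ℝ} {w : ℕ → ℝ} {C : ℝ} {S : Set ℝ}
    (hu : ∀ m, Continuous fun E => u E m) (hb : ∀ E ∈ S, ∀ m, |u E m| ≤ (19 / 20) ^ m)
    (hw : ∀ m, |w m| ≤ C) : ContinuousOn (fun E => ∑' m, u E m * w m) S := by
  refine continuousOn_tsum (u := fun m => (19 / 20) ^ m * C)
    (fun m => ((hu m).mul continuous_const).continuousOn)
    ((summable_geometric_of_lt_one (by norm_num) (by norm_num)).mul_right C) fun m E hE => ?_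
  rw [Real.norm_eq_abs, abs_mul]
  exact mul_le_mul (hb E hE m) (hw m) (abs_nonneg _) (by positivity)

theorem abs_tsum_mul_le {a w : ℕ → ℝ} {C : ℝ} (ha : Summable a) (hw : ∀ m, |w m| ≤ C) :
    |∑' m, a m * w m| ≤ C * ∑' m, |a m| := by
  have h1 : Summable fun m => ‖a m * w m‖ := (summable_mul_of_abs_le ha hw).norm
  calc |∑' m, a m * w m| ≤ ∑' m, ‖a m * w m‖ := norm_tsum_le_tsum_norm h1
    _ ≤ ∑' m, C * |a m| := by
      refine h1.tsum_le_tsum (fun m => ?_) (ha.abs.mul_left C)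
      rw [Real.norm_eq_abs, abs_mul, mul_comm]
      exact mul_le_mul_of_nonneg_right (hw m) (abs_nonneg _)
    _ = _ := tsum_mul_left

theorem abs_div_one_sub_pow_le {r x : ℝ} (hr0 : 0 < r) (hr1 : r < 1) (hx : 0 ≤ x) {n : ℕ}
    (hn : n ≠ 0) (m : ℕ) : |x / (1 - r ^ (2 * m + n))| ≤ x / (1 - r ^ n) := by
  have h1 : r ^ (2 * m + n) ≤ r ^ n := pow_le_pow_of_le_one hr0.le hr1.le (by omega)
  have h2 : r ^ n < 1 := pow_lt_one₀ hr0.le hr1 hn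
  rw [abs_of_nonneg (div_nonneg hx (by linarith))]
  exact div_le_div_of_nonneg_left hx (by linarith) (by linarith)

/-- The coefficient of `c 0` in the inner energy condition. -/
noncomputable def entryA (P E : ℝ) : ℝ :=
  scale P⁻¹ * ∑' m, innerSol P E m * (1 / (P ^ 2 * (P⁻¹) ^ (2 * m) - 1)) - E

/-- The coefficient of `k 5` in the inner energy condition. -/
noncomputable def entryB (P E : ℝ) : ℝ :=
  -(scale P⁻¹ * ∑' m, outerSol P E m * ((P⁻¹) ^ 7 / (1 - (P⁻¹) ^ (2 * m + 7))))

/-- The coefficient of `c 0` in the outer energy condition. -/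
noncomputable def entryC (P E : ℝ) : ℝ :=
  scale P⁻¹ * ∑' m, innerSol P E m * (1 / (1 - (P⁻¹) ^ (2 * m + 1)))

/-- The coefficient of `k 5` in the outer energy condition. -/
noncomputable def entryD (P E : ℝ) : ℝ :=
  scale P⁻¹ * ∑' m, outerSol P E m * ((P⁻¹) ^ 4 / (1 - (P⁻¹) ^ (2 * m + 4))) - 1

theorem continuousOn_det (hP : 2 ≤ P) :
    ContinuousOn (fun E => entryA P E * entryD P E - entryB P E * entryC P E)
      (Set.Icc (-1) (5 / 2)) := by
  obtain ⟨hr0, hr1⟩ := inv_mem hP rfl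
  have hS : ∀ E ∈ Set.Icc (-1 : ℝ) (5 / 2), |E| ≤ 5 / 2 := by
    rintro E ⟨h1, h2⟩
    rw [abs_le]; constructor <;> linarith
  have hA : ContinuousOn (entryA P) (Set.Icc (-1) (5 / 2)) :=
    (continuousOn_const.mul (continuousOn_tsum_mul (continuous_innerSol P)
      (fun E hE => abs_innerSol_le hP (hS E hE)) (abs_inner_weight_le hP rfl))).sub continuousOn_id
  have hB : ContinuousOn (entryB P) (Set.Icc (-1) (5 / 2)) :=
    (continuousOn_const.mul (continuousOn_tsum_mul (continuous_outerSol P)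
      (fun E hE => abs_outerSol_le hP (hS E hE))
      (abs_div_one_sub_pow_le hr0 hr1 (by positivity) (by norm_num)))).neg
  have hC : ContinuousOn (entryC P) (Set.Icc (-1) (5 / 2)) :=
    continuousOn_const.mul (continuousOn_tsum_mul (continuous_innerSol P)
      (fun E hE => abs_innerSol_le hP (hS E hE))
      (abs_div_one_sub_pow_le hr0 hr1 (by positivity) (by norm_num)))
  have hD : ContinuousOn (entryD P) (Set.Icc (-1) (5 / 2)) :=
    (continuousOn_const.mul (continuousOn_tsum_mul (continuous_outerSol P)
      (fun E hE => abs_outerSol_le hP (hS E hE))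
      (abs_div_one_sub_pow_le hr0 hr1 (by positivity) (by norm_num)))).sub continuousOn_const
  exact (hA.mul hD).sub (hB.mul hC)

/-- The `ℓ¹` norm of the coefficients `c 4, c 6, …`. -/
noncomputable def innerTail (P E : ℝ) : ℝ := ∑' m, |innerSol P E (m + 2)|

/-- The `ℓ¹` norm of the coefficients off the unit ball. -/
noncomputable def outerNorm (P E : ℝ) : ℝ := ∑' m, |outerSol P E m|

theorem innerTail_nonneg : 0 ≤ innerTail P E := tsum_nonneg fun _ => abs_nonneg _

theorem outerNorm_nonneg : 0 ≤ outerNorm P E := tsum_nonneg fun _ => abs_nonneg _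

theorem abs_innerSol_step_le {e : ℝ} (hP : 2 ≤ P) (hE : |E| ≤ e) (m : ℕ) :
    |innerSol P E (m + 2)| ≤ e * (P⁻¹) ^ 2 * |innerSol P E (m + 1)| +
      (P⁻¹) ^ 2 * |innerSol P E m| := by
  obtain ⟨h1, h2⟩ := abs_inner_coeff_le hP hE (m := m + 1) (by omega)
  rw [(isInnerRec_innerSol hP).step' hP m]
  refine (abs_sub _ _).trans ?_
  rw [abs_mul, abs_mul]
  gcongr

/-- Starting at index `2` is efficient because `u 1 = 0` gives `|u 3| ≤ e P⁻² |u 2|`, which the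
factor `1 - e P⁻²` in front of `|u 2|` compensates. -/
theorem innerTail_le {e : ℝ} (hP : 2 ≤ P) (hE : |E| ≤ e) (he : e ≤ 5 / 2) :
    (1 - (e + 1) * (P⁻¹) ^ 2) * innerTail P E ≤ |innerSol P E 2| := by
  have h := tsum_abs_le_of_rec (u := fun m => innerSol P E (m + 2))
    ((summable_nat_add_iff 2).2 (summable_innerSol hP (hE.trans he)))
    (fun m => abs_innerSol_step_le hP hE (m + 2))
  have h1 := abs_innerSol_step_le hP hE 1
  have h0 : innerSol P E 1 = 0 := rfl
  rw [h0, abs_zero, mul_zero, add_zero] at h1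
  simp only [zero_add] at h
  change _ ≤ _ + |innerSol P E (1 + 2)| at h
  unfold innerTail
  nlinarith

theorem abs_innerSol_two_le (hP : 2 ≤ P) : |innerSol P E 2| ≤ (P⁻¹) ^ 2 := by
  have := abs_innerSol_step_le hP (le_refl |E|) 0
  simpa [innerSol] using this

theorem abs_outerSol_step_le {e : ℝ} (hP : 2 ≤ P) (hE : |E| ≤ e) (m : ℕ) :
    |outerSol P E (m + 2)| ≤ e * (P⁻¹) ^ 2 * |outerSol P E (m + 1)| +
      9 / 8 * (P⁻¹) ^ 2 * |outerSol P E m| := by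
  obtain ⟨h1, h2⟩ := abs_outer_coeff_le hP hE
  rw [(isOuterRec_outerSol hP).step' hP]
  refine (abs_sub _ _).trans ?_
  rw [abs_mul, abs_mul]
  gcongr
  exact h2 m

theorem outerNorm_le {e : ℝ} (hP : 2 ≤ P) (hE : |E| ≤ e) (he : e ≤ 5 / 2) :
    (1 - (e + 9 / 8) * (P⁻¹) ^ 2) * outerNorm P E ≤ 1 := by
  have h := tsum_abs_le_of_rec (summable_outerSol hP (hE.trans he))
    (abs_outerSol_step_le hP hE)
  have h3 : outerSol P E 1 = E / P ^ 2 := by rw [outerSol]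
  have h4 : outerSol P E 0 = 1 := by rw [outerSol]
  have h1 := (abs_outer_coeff_le hP hE).1
  rw [h3, h4, abs_one] at h
  unfold outerNorm
  linarith

/-- The term `m = 0` contributes exactly `1/(1+r+r²)` and the term `m = 1` nothing; the rest have
weights at most `1/(1-r²)` in absolute value. Thus `A` changes sign near `E = 1/(1+r+r²)`. -/
theorem abs_entryA_sub_le (hP : 2 ≤ P) (hE : |E| ≤ 5 / 2) :
    |entryA P E + E - 1 / (1 + P⁻¹ + (P⁻¹) ^ 2)| ≤
      innerTail P E / ((P⁻¹) ^ 2 * (1 + P⁻¹ + (P⁻¹) ^ 2)) := by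
  obtain ⟨hr0, hr1⟩ := inv_mem hP rfl
  have hs := scale_pos hr0 hr1
  have hsum := summable_innerSol hP hE
  have hPr : P * P⁻¹ = 1 := mul_inv_cancel₀ (by positivity)
  have h := (summable_mul_of_abs_le hsum (abs_inner_weight_le hP rfl)).sum_add_tsum_nat_add 2
  rw [Finset.sum_range_succ, Finset.sum_range_one] at h
  have hshift : ∀ m : ℕ, P ^ 2 * (P⁻¹) ^ (2 * (m + 2)) - 1 = -(1 - (P⁻¹) ^ (2 * m + 2)) := by
    intro m
    calc _ = (P * P⁻¹) ^ 2 * (P⁻¹) ^ (2 * m + 2) - 1 := by ring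
      _ = _ := by rw [hPr]; ring
  have hb := abs_tsum_mul_le ((summable_nat_add_iff 2).2 hsum)
    (w := fun m => 1 / (P ^ 2 * (P⁻¹) ^ (2 * (m + 2)) - 1)) (C := 1 / (1 - (P⁻¹) ^ 2))
    (fun m => by
      rw [hshift, div_neg, abs_neg]
      exact abs_div_one_sub_pow_le hr0 hr1 (by positivity) (by norm_num) m)
  have h2 : 1 - (P⁻¹) ^ 2 ≠ 0 := by have := inv_sq_le hP; linarith
  have e1 : scale P⁻¹ * (1 / (P ^ 2 * (P⁻¹) ^ (2 * 0) - 1)) = 1 / (1 + P⁻¹ + (P⁻¹) ^ 2) := by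
    have e : P ^ 2 * (P⁻¹) ^ (2 * 0) - 1 = (1 - (P⁻¹) ^ 2) / (P⁻¹) ^ 2 := by
      field_simp
      ring
    rw [e, scale, one_div_div]
    have : 1 + P⁻¹ + (P⁻¹) ^ 2 ≠ 0 := by positivity
    have : (P⁻¹) ^ 2 ≠ 0 := by positivity
    generalize (P⁻¹) ^ 2 = Y at *
    generalize 1 + P⁻¹ + Y = Z at *
    field_simp
  have e2 : scale P⁻¹ * (1 / (1 - (P⁻¹) ^ 2)) = 1 / ((P⁻¹) ^ 2 * (1 + P⁻¹ + (P⁻¹) ^ 2)) := by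
    rw [scale, div_mul_div_cancel₀' h2, one_div]
  have e3 : entryA P E + E - 1 / (1 + P⁻¹ + (P⁻¹) ^ 2) = scale P⁻¹ *
      ∑' m, innerSol P E (m + 2) * (1 / (P ^ 2 * (P⁻¹) ^ (2 * (m + 2)) - 1)) := by
    rw [entryA, ← h, ← e1]
    simp only [innerSol]
    ring
  rw [e3, abs_mul, abs_of_pos hs]
  calc _ ≤ scale P⁻¹ * (1 / (1 - (P⁻¹) ^ 2) * ∑' m, |innerSol P E (m + 2)|) := by gcongr
    _ = _ := by rw [← mul_assoc, e2, innerTail, one_div_mul_eq_div]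

theorem abs_entryB_le (hP : 2 ≤ P) (hE : |E| ≤ 5 / 2) :
    |entryB P E| ≤ scale P⁻¹ * ((P⁻¹) ^ 7 / (1 - (P⁻¹) ^ 7) * outerNorm P E) := by
  obtain ⟨hr0, hr1⟩ := inv_mem hP rfl
  have hs := scale_pos hr0 hr1
  rw [entryB, abs_neg, abs_mul, abs_of_pos hs]
  gcongr
  exact abs_tsum_mul_le (summable_outerSol hP hE)
    (abs_div_one_sub_pow_le hr0 hr1 (by positivity) (by norm_num))

theorem abs_entryC_le (hP : 2 ≤ P) (hE : |E| ≤ 5 / 2) :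
    |entryC P E| ≤ scale P⁻¹ * (1 / (1 - P⁻¹) * (1 + innerTail P E)) := by
  obtain ⟨hr0, hr1⟩ := inv_mem hP rfl
  have hs := scale_pos hr0 hr1
  have h : ∑' m, |innerSol P E m| = 1 + innerTail P E := by
    have := (summable_innerSol hP hE).abs.sum_add_tsum_nat_add 2
    rw [← this, Finset.sum_range_succ, Finset.sum_range_one]
    simp [innerSol, innerTail]
  rw [entryC, abs_mul, abs_of_pos hs, ← h]
  gcongr
  have := abs_tsum_mul_le (summable_innerSol hP hE)
    (abs_div_one_sub_pow_le (x := 1) hr0 hr1 (by positivity) one_ne_zero)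
  rwa [pow_one] at this

theorem entryD_add_one_le (hP : 2 ≤ P) (hE : |E| ≤ 5 / 2) :
    entryD P E + 1 ≤ scale P⁻¹ * ((P⁻¹) ^ 4 / (1 - (P⁻¹) ^ 4) * outerNorm P E) := by
  obtain ⟨hr0, hr1⟩ := inv_mem hP rfl
  have hs := scale_pos hr0 hr1
  rw [entryD, sub_add_cancel]
  gcongr
  exact (le_abs_self _).trans (abs_tsum_mul_le (summable_outerSol hP hE)
    (abs_div_one_sub_pow_le hr0 hr1 (by positivity) (by norm_num)))

end Existence

/-! ### Signs of the determinant at the two end points -/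

section Sign

variable {P E : ℝ}

theorem abs_entryB_mul_entryC_le (hP : 2 ≤ P) (hE : |E| ≤ 5 / 2) :
    |entryB P E * entryC P E| ≤ (P⁻¹) ^ 3 * (1 - P⁻¹) / (1 - (P⁻¹) ^ 7) *
      (outerNorm P E * (1 + innerTail P E)) := by
  obtain ⟨hr0, hr1⟩ := inv_mem hP rfl
  have hs := scale_pos hr0 hr1
  have hS := outerNorm_nonneg (P := P) (E := E)
  have hT := innerTail_nonneg (P := P) (E := E)
  have h7 : 0 < 1 - (P⁻¹) ^ 7 := sub_pos.2 (pow_lt_one₀ hr0.le hr1 (by norm_num))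
  have h1 : 0 < 1 - P⁻¹ := sub_pos.2 hr1
  rw [abs_mul]
  calc _ ≤ (scale P⁻¹ * ((P⁻¹) ^ 7 / (1 - (P⁻¹) ^ 7) * outerNorm P E)) *
        (scale P⁻¹ * (1 / (1 - P⁻¹) * (1 + innerTail P E))) :=
      mul_le_mul (abs_entryB_le hP hE) (abs_entryC_le hP hE) (abs_nonneg _) (by positivity)
    _ = (scale P⁻¹ ^ 2 * (P⁻¹) ^ 4 / (1 - P⁻¹) ^ 2) * ((P⁻¹) ^ 3 * (1 - P⁻¹) / (1 - (P⁻¹) ^ 7) *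
        (outerNorm P E * (1 + innerTail P E))) := by
      generalize 1 - (P⁻¹) ^ 7 = X at *
      generalize 1 - P⁻¹ = Y at *
      field_simp
    _ ≤ 1 * ((P⁻¹) ^ 3 * (1 - P⁻¹) / (1 - (P⁻¹) ^ 7) *
        (outerNorm P E * (1 + innerTail P E))) := by
      -- The remaining prefactor is at most `1` because `scale r · r² ≤ 1 - r`, that is, `1 + r ≤ 1
      -- + r + r²`.
      gcongr
      rw [div_le_one (by positivity), show scale P⁻¹ ^ 2 * (P⁻¹) ^ 4 = (scale P⁻¹ * (P⁻¹) ^ 2) ^ 2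
        by ring]
      gcongr
      rw [scale, div_mul_eq_mul_div, div_le_iff₀ (by positivity)]
      have : 0 < (P⁻¹) ^ 2 := by positivity
      nlinarith [mul_pos this h1, mul_pos (mul_pos this hr0) h1, mul_pos (mul_pos this this) h1]
    _ = _ := one_mul _

theorem entryD_le (hP : 2 ≤ P) (hE : |E| ≤ 5 / 2) :
    entryD P E + 1 ≤ (P⁻¹) ^ 2 / ((1 + P⁻¹ + (P⁻¹) ^ 2) * (1 + (P⁻¹) ^ 2)) * outerNorm P E := by
  refine (entryD_add_one_le hP hE).trans_eq ?_
  obtain ⟨hr0, hr1⟩ := inv_mem hP rfl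
  generalize P⁻¹ = r at *
  have h2 : 1 - r ^ 2 ≠ 0 := by nlinarith
  have h4 : 1 - r ^ 4 = (1 - r ^ 2) * (1 + r ^ 2) := by ring
  rw [← mul_assoc, scale, h4]
  congr 1
  have h5 : 1 + r + r ^ 2 ≠ 0 := by positivity
  field_simp

theorem det_neg {A B C D a d : ℝ} (ha : 0 < a) (hd : 0 < d) (hA : a ≤ A) (hD : D ≤ -d)
    (hBC : |B * C| < a * d) : A * D - B * C < 0 := by
  have := (abs_lt.1 hBC).1
  nlinarith

theorem det_pos {A B C D a d : ℝ} (ha : 0 < a) (hd : 0 < d) (hA : A ≤ -a) (hD : D ≤ -d)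
    (hBC : |B * C| < a * d) : 0 < A * D - B * C := by
  have := (abs_lt.1 hBC).2
  nlinarith

theorem inv_le_third (hP : 3 ≤ P) : P⁻¹ ≤ 1 / 3 := by
  rw [one_div]; exact inv_anti₀ (by norm_num) hP

theorem innerTail_le_of_three_le (hP : 3 ≤ P) (hE : |E| ≤ 5 / 2) :
    (1 - 7 / 2 * (P⁻¹) ^ 2) * innerTail P E ≤ (P⁻¹) ^ 2 := by
  have hP2 : 2 ≤ P := by linarith
  have h := (innerTail_le hP2 hE le_rfl).trans (abs_innerSol_two_le hP2)
  norm_num at h ⊢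
  exact h

theorem entryB_mul_entryC_lt_of_three_le (hP : 3 ≤ P) (hE : |E| ≤ 5 / 2) :
    |entryB P E * entryC P E| ≤ 1 / 10 ∧ entryD P E ≤ -(4 / 5) := by
  have hP2 : 2 ≤ P := by linarith
  obtain ⟨hr0, hr1⟩ := inv_mem hP2 rfl
  have hr := inv_le_third hP
  have hS := outerNorm_nonneg (P := P) (E := E)
  have hT := innerTail_nonneg (P := P) (E := E)
  have h1 := outerNorm_le hP2 hE le_rfl
  have h2 := innerTail_le_of_three_le hP hE
  have h3 := abs_entryB_mul_entryC_le hP2 hE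
  have h4 := entryD_le hP2 hE
  generalize outerNorm P E = S at *
  generalize innerTail P E = T at *
  generalize P⁻¹ = r at *
  have hr2 : r ^ 2 ≤ 1 / 9 := by nlinarith
  have hr20 : 0 < r ^ 2 := by positivity
  have hS' : S ≤ 17 / 10 := by nlinarith
  have hT' : T ≤ 1 / 5 := by nlinarith
  have hr7 : r ^ 7 ≤ r := pow_le_of_le_one hr0.le hr1.le (by norm_num)
  constructor
  · refine h3.trans ?_
    have : r ^ 3 * (1 - r) / (1 - r ^ 7) ≤ 1 / 27 := by
      rw [div_le_iff₀ (by linarith)]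
      have : r ^ 3 ≤ 1 / 27 := by
        have := pow_le_pow_left₀ hr0.le hr 3
        norm_num at this ⊢
        exact this
      have h0 : 0 < r ^ 3 := by positivity
      nlinarith
    calc r ^ 3 * (1 - r) / (1 - r ^ 7) * (S * (1 + T)) ≤ 1 / 27 * (17 / 10 * (1 + 1 / 5)) := by
          gcongr
      _ ≤ 1 / 10 := by norm_num
  · have : r ^ 2 / ((1 + r + r ^ 2) * (1 + r ^ 2)) ≤ 1 / 9 := by
      rw [div_le_iff₀ (by positivity)]
      nlinarith [mul_pos hr0 hr20]
    have : r ^ 2 / ((1 + r + r ^ 2) * (1 + r ^ 2)) * S ≤ 1 / 9 * (17 / 10) := by gcongr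
    linarith

theorem det_pos_of_three_le (hP : 3 ≤ P) :
    0 < entryA P (5 / 2) * entryD P (5 / 2) - entryB P (5 / 2) * entryC P (5 / 2) := by
  have hP2 : 2 ≤ P := by linarith
  have hE : |(5 / 2 : ℝ)| ≤ 5 / 2 := by norm_num
  obtain ⟨h1, h2⟩ := entryB_mul_entryC_lt_of_three_le hP hE
  refine det_pos (a := 1 / 2) (d := 4 / 5) (by norm_num) (by norm_num) ?_ h2 (by linarith)
  have h3 := (abs_le.1 (abs_entryA_sub_le hP2 hE)).2
  have h4 := innerTail_le_of_three_le hP hE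
  obtain ⟨hr0, hr1⟩ := inv_mem hP2 rfl
  have hr := inv_le_third hP
  generalize innerTail P (5 / 2) = T at *
  generalize P⁻¹ = r at *
  have hr2 : 0 < r ^ 2 := by positivity
  have h5 : T / (r ^ 2 * (1 + r + r ^ 2)) ≤ 2 - 1 / (1 + r + r ^ 2) := by
    rw [div_le_iff₀ (by positivity)]
    have e : (2 - 1 / (1 + r + r ^ 2)) * (r ^ 2 * (1 + r + r ^ 2)) =
        r ^ 2 * (1 + 2 * r + 2 * r ^ 2) := by field_simp; ring
    rw [e]
    have hq : 0 < 1 - 7 / 2 * r ^ 2 := by nlinarith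
    -- Inserting the tail bound, `A ≤ -1/2` reduces to this inequality, whose difference of sides is
    -- `r` times the quantity in `h7`.
    have h6 : 1 ≤ (1 - 7 / 2 * r ^ 2) * (1 + 2 * r + 2 * r ^ 2) := by
      have h7 : 0 ≤ 2 - 3 / 2 * r - 7 * r ^ 2 - 7 * r ^ 3 := by nlinarith
      nlinarith [mul_nonneg hr0.le h7]
    have h8 : (1 - 7 / 2 * r ^ 2) * T ≤
        (1 - 7 / 2 * r ^ 2) * (r ^ 2 * (1 + 2 * r + 2 * r ^ 2)) := by
      refine h4.trans ?_
      nlinarith [mul_le_mul_of_nonneg_left h6 hr2.le]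
    exact le_of_mul_le_mul_left h8 hq
  linarith

theorem det_neg_of_three_le (hP : 3 ≤ P) :
    entryA P (-1) * entryD P (-1) - entryB P (-1) * entryC P (-1) < 0 := by
  have hP2 : 2 ≤ P := by linarith
  have hE : |(-1 : ℝ)| ≤ 5 / 2 := by norm_num
  obtain ⟨h1, h2⟩ := entryB_mul_entryC_lt_of_three_le hP hE
  refine det_neg (a := 1 / 4) (d := 4 / 5) (by norm_num) (by norm_num) ?_ h2 (by linarith)
  have h3 := (abs_le.1 (abs_entryA_sub_le hP2 hE)).1
  have h4 := innerTail_le_of_three_le hP hE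
  obtain ⟨hr0, hr1⟩ := inv_mem hP2 rfl
  have hr := inv_le_third hP
  have hT := innerTail_nonneg (P := P) (E := -1)
  generalize innerTail P (-1) = T at *
  generalize P⁻¹ = r at *
  have hr2 : 0 < r ^ 2 := by positivity
  have hr29 : r ^ 2 ≤ 1 / 9 := by nlinarith
  have h5 : T / (r ^ 2 * (1 + r + r ^ 2)) - 1 / (1 + r + r ^ 2) ≤ 3 / 4 := by
    rw [div_sub_div _ _ (by positivity) (by positivity), div_le_iff₀ (by positivity)]
    have h6 : T ≤ 7 / 4 * r ^ 2 := by nlinarith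
    have h7 : 0 < 1 + r + r ^ 2 := by positivity
    nlinarith [mul_pos hr2 h7, mul_pos (mul_pos hr2 h7) hr0, mul_pos (mul_pos hr2 h7) hr2]
  linarith

/-- Common numerical step for `P = 2`. The thresholds `4/9` and `32/15` are tuned to `E = -1`, where
the a priori bounds are `31/70` and `32/15`, and they are also met at `E = 2`. -/
theorem innerTail_two {E : ℝ} (hE : |E| ≤ 5 / 2) (h : innerTail 2 E ≤ 4 / 9)
    (hS : outerNorm 2 E ≤ 32 / 15) :
    |entryB 2 E * entryC 2 E| ≤ 1 / 5 ∧ entryD 2 E ≤ -(3 / 4) := by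
  have h3 := abs_entryB_mul_entryC_le le_rfl hE
  have h4 := entryD_le le_rfl hE
  have hS0 := outerNorm_nonneg (P := 2) (E := E)
  have hT0 := innerTail_nonneg (P := 2) (E := E)
  constructor
  · refine h3.trans ?_
    calc _ ≤ ((2 : ℝ)⁻¹) ^ 3 * (1 - 2⁻¹) / (1 - (2⁻¹) ^ 7) * (32 / 15 * (1 + 4 / 9)) := by
          gcongr
      _ ≤ _ := by norm_num
  · norm_num at h4
    linarith

theorem det_neg_two :
    entryA 2 (-1) * entryD 2 (-1) - entryB 2 (-1) * entryC 2 (-1) < 0 := by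
  have hE : |(-1 : ℝ)| ≤ 1 := by norm_num
  have hE' : |(-1 : ℝ)| ≤ 5 / 2 := by norm_num
  have h0 : |innerSol 2 (-1) 2| = 31 / 140 := by
    norm_num [innerSol, growthFactor]
  have h1 := innerTail_le le_rfl hE (by norm_num)
  have h2 := outerNorm_le le_rfl hE (by norm_num)
  rw [h0] at h1
  norm_num at h1 h2
  obtain ⟨h3, h4⟩ := innerTail_two hE' (by linarith) (by linarith)
  refine det_neg (a := 1 / 2) (d := 3 / 4) (by norm_num) (by norm_num) ?_ h4 (by linarith)
  have h5 := (abs_le.1 (abs_entryA_sub_le le_rfl hE')).1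
  norm_num at h5
  linarith

theorem innerSol_two_two : innerSol 2 2 2 = -31 / 140 ∧ innerSol 2 2 3 = -127 / 1176 ∧
    |innerSol 2 2 4| ≤ 7 / 5000 ∧ |innerSol 2 2 5| ≤ 277 / 10000 := by
  have h2 : innerSol 2 2 2 = -31 / 140 := by norm_num [innerSol, growthFactor]
  have h3 : innerSol 2 2 3 = -127 / 1176 := by
    rw [innerSol, h2]; norm_num [innerSol, growthFactor]
  have h4 : innerSol 2 2 4 = 73 / 53975 := by
    rw [innerSol, h2, h3]; norm_num [growthFactor]
  refine ⟨h2, h3, by rw [h4]; norm_num, ?_⟩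
  rw [innerSol, h3, h4]
  norm_num [growthFactor]

theorem outerSol_two_two : |outerSol 2 2 2| ≤ 1 / 150 ∧ |outerSol 2 2 3| ≤ 13 / 100 := by
  have h2 : outerSol 2 2 2 = -4 / 635 := by norm_num [outerSol, growthFactor]
  refine ⟨by rw [h2]; norm_num, ?_⟩
  rw [outerSol, h2]
  norm_num [outerSol, growthFactor]

/-- At `E = 2` the a priori bounds for `P = 2` are too weak: they only give `31/35` for the inner
tail and `32/7` for the outer norm. Hence the first coefficients are computed exactly and the
contraction estimate is applied only from index `4` (inner) and `2` (outer). -/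
theorem det_pos_two :
    0 < entryA 2 2 * entryD 2 2 - entryB 2 2 * entryC 2 2 := by
  have hE : |(2 : ℝ)| ≤ 2 := by norm_num
  have hE' : |(2 : ℝ)| ≤ 5 / 2 := by norm_num
  obtain ⟨u2, u3, u4, u5⟩ := innerSol_two_two
  obtain ⟨b2, b3⟩ := outerSol_two_two
  have hsum := summable_innerSol le_rfl hE'
  have hsumb := summable_outerSol le_rfl hE'
  -- tails of the two coefficient sequences
  have hT' := tsum_abs_le_of_rec (u := fun m => innerSol 2 2 (m + 4))
    ((summable_nat_add_iff 4).2 hsum) (fun m => abs_innerSol_step_le le_rfl hE (m + 4))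
  have hS' := tsum_abs_le_of_rec (u := fun m => outerSol 2 2 (m + 2))
    ((summable_nat_add_iff 2).2 hsumb) (fun m => abs_outerSol_step_le le_rfl hE (m + 2))
  norm_num at hT' hS'
  have hT'' : ∑' m, |innerSol 2 2 (m + 4)| ≤ 142 / 1250 := by linarith
  have hS'' : ∑' m, |outerSol 2 2 (m + 2)| ≤ 62 / 100 := by linarith
  have hT : innerTail 2 2 ≤ 4 / 9 := by
    have := ((summable_nat_add_iff 2).2 hsum).abs.sum_add_tsum_nat_add 2
    rw [Finset.sum_range_succ, Finset.sum_range_one] at this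
    rw [innerTail, ← this]
    simp only [zero_add, Nat.reduceAdd, add_assoc] at hT'' ⊢
    rw [u2, u3]
    norm_num at hT'' ⊢
    linarith
  have hS : outerNorm 2 2 ≤ 32 / 15 := by
    have := hsumb.abs.sum_add_tsum_nat_add 2
    rw [Finset.sum_range_succ, Finset.sum_range_one] at this
    rw [outerNorm, ← this]
    norm_num [outerSol] at hS'' ⊢
    linarith
  obtain ⟨h3, h4⟩ := innerTail_two hE' hT hS
  refine det_pos (a := 1 / 2) (d := 3 / 4) (by norm_num) (by norm_num) ?_ h4 (by linarith)
  have hw := summable_mul_of_abs_le hsum (abs_inner_weight_le le_rfl rfl)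
  have hsplit := hw.sum_add_tsum_nat_add 4
  -- The weights from `m = 4` on are at most `1/(1 - 2^(-6)) = 64/63` in absolute value.
  have hb := abs_tsum_mul_le ((summable_nat_add_iff 4).2 hsum)
    (w := fun m => 1 / ((2 : ℝ) ^ 2 * ((2 : ℝ)⁻¹) ^ (2 * (m + 4)) - 1)) (C := 64 / 63)
    (fun m => by
      have e : (2 : ℝ) ^ 2 * ((2 : ℝ)⁻¹) ^ (2 * (m + 4)) - 1 =
          -(1 - ((2 : ℝ)⁻¹) ^ (2 * m + 6)) := by ring
      rw [e, div_neg, abs_neg]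
      refine (abs_div_one_sub_pow_le (by norm_num) (by norm_num) zero_le_one (by norm_num)
        m).trans ?_
      norm_num)
  have hb' := (abs_le.1 hb).2
  rw [entryA, ← hsplit, Finset.sum_range_succ, Finset.sum_range_succ, Finset.sum_range_succ,
    Finset.sum_range_one, u2, u3, show innerSol 2 2 0 = 1 from rfl, show innerSol 2 2 1 = 0 from rfl]
  have hsc : scale (2 : ℝ)⁻¹ = 12 / 7 := by norm_num [scale]
  rw [hsc]
  norm_num at hb' ⊢
  linarith

end Sign

/-! ### The intermediate value theorem and assembly of a nonzero solution -/

section Main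

/-- The coefficients `c` on the unit ball from their even part. -/
noncomputable def extendInner (C : ℕ → ℝ) (n : ℕ) : ℝ := if n % 2 = 0 then C (n / 2) else 0

/-- The coefficients `k` off the unit ball from their rescaled part. -/
noncomputable def extendOuter (P : ℝ) (b : ℕ → ℝ) (n : ℕ) : ℝ :=
  if n % 2 = 1 ∧ 5 ≤ n then b ((n - 5) / 2) * P ^ (n - 5) else 0

theorem extendInner_even (C : ℕ → ℝ) (m : ℕ) : extendInner C (2 * m) = C m := by
  rw [extendInner, if_pos (by omega)]
  congr 1; omega

theorem extendOuter_odd (P : ℝ) (b : ℕ → ℝ) (m : ℕ) :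
    extendOuter P b (2 * m + 5) = b m * P ^ (2 * m) := by
  rw [extendOuter, if_pos (by omega), Nat.add_sub_cancel, Nat.mul_div_cancel_left _ two_pos]

variable {p : ℕ} [hp : Fact p.Prime] {E : ℝ}

theorem isCoeff_extend {C b : ℕ → ℝ} (hC : IsInnerRec p E C) (hb : IsOuterRec p E b) :
    IsCoeff p 1 E (extendInner C) (extendOuter p b) where
  c_odd n := by rw [extendInner, if_neg (by omega)]
  c_two := by rw [← mul_one 2, extendInner_even, hC.one]
  c_rec n := by
    rw [Gam_ratio_pos, show 2 * n + 4 = 2 * (n + 2) by ring, show 2 * n + 2 = 2 * (n + 1) by ring,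
      extendInner_even, extendInner_even, extendInner_even]
    linarith [hC.step n]
  k_even n _ := by rw [extendOuter, if_neg (by omega)]
  k_one := by rw [extendOuter, if_neg (by omega)]
  k_three := by rw [extendOuter, if_neg (by omega)]
  k_rec n hn := by
    rw [Gam_ratio_neg hn, extendOuter_odd]
    match n, hn with
    | 1, _ =>
      have h3 : extendOuter p b (2 * 1 + 1) = 0 := by rw [extendOuter, if_neg (by omega)]
      have h5 := extendOuter_odd p b 0
      rw [show 2 * 1 + 3 = 2 * 0 + 5 by ring, h3, h5]
      simp only [mul_zero, mul_one, pow_zero]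
      linarith [hb.one]
    | n + 2, _ =>
      rw [show 2 * (n + 2) + 1 = 2 * n + 5 by ring, show 2 * (n + 2) + 3 = 2 * (n + 1) + 5 by ring,
        extendOuter_odd, extendOuter_odd]
      have := hb.step n
      rw [show (p : ℝ) ^ (2 * (n + 2)) = p ^ 2 * p ^ (2 * (n + 1)) by ring,
        show (p : ℝ) ^ (2 * (n + 1)) = p ^ 2 * p ^ (2 * n) by ring]
      linear_combination (p : ℝ) ^ 2 * (p : ℝ) ^ (2 * n) * this

theorem IsInnerRec.const_mul {P : ℝ} {u : ℕ → ℝ} (h : IsInnerRec P E u) (x : ℝ) :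
    IsInnerRec P E fun m => x * u m where
  one := by rw [h.one, mul_zero]
  step m := by linear_combination x * h.step m

theorem IsOuterRec.const_mul {P : ℝ} {u : ℕ → ℝ} (h : IsOuterRec P E u) (x : ℝ) :
    IsOuterRec P E fun m => x * u m where
  one := by linear_combination x * h.one
  step m := by linear_combination x * h.step m

theorem exists_det_eq_zero {P : ℝ} (hP : P = 2 ∨ 3 ≤ P) :
    ∃ E, entryA P E * entryD P E - entryB P E * entryC P E = 0 := by
  have hP2 : 2 ≤ P := by rcases hP with rfl | h <;> linarith
  obtain ⟨E₁, h1, h2, hneg, hpos⟩ : ∃ E₁ : ℝ, -1 ≤ E₁ ∧ E₁ ≤ 5 / 2 ∧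
      entryA P (-1) * entryD P (-1) - entryB P (-1) * entryC P (-1) < 0 ∧
      0 < entryA P E₁ * entryD P E₁ - entryB P E₁ * entryC P E₁ := by
    rcases hP with rfl | h
    · exact ⟨2, by norm_num, by norm_num, det_neg_two, det_pos_two⟩
    · exact ⟨5 / 2, by norm_num, le_rfl, det_neg_of_three_le h, det_pos_of_three_le h⟩
  obtain ⟨E, -, hE⟩ := intermediate_value_Icc h1
    ((continuousOn_det hP2).mono (Set.Icc_subset_Icc_right h2)) ⟨hneg.le, hpos.le⟩
  exact ⟨E, hE⟩

theorem exists_ne_zero_of_det_eq_zero {A B C D : ℝ} (h : A * D - B * C = 0) :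
    ∃ x y : ℝ, (x ≠ 0 ∨ y ≠ 0) ∧ x * A + y * B = 0 ∧ x * C + y * D = 0 := by
  by_cases hAB : A = 0 ∧ B = 0
  · obtain ⟨rfl, rfl⟩ := hAB
    by_cases hCD : C = 0 ∧ D = 0
    · exact ⟨1, 0, by simp [hCD.1]⟩
    · refine ⟨-D, C, ?_, by ring, by ring⟩
      rw [neg_ne_zero, or_comm]
      exact not_and_or.1 hCD
  · refine ⟨-B, A, ?_, by ring, by linarith⟩
    rw [neg_ne_zero, or_comm]
    exact not_and_or.1 hAB

/-- The solutions of the recursions normalised by `c_0 = 1` and `k_5 = 1` are scaled by a kernel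
vector `(x, y)` of the singular system; linearity turns the energy conditions into the two kernel
equations. -/
theorem exists_eigenvalue (p : ℕ) [hp : Fact p.Prime] :
    ∃ (E : ℝ) (c k : ℕ → ℝ), IsCoeff p 1 E c k ∧ EnergyCondition p 1 E c k ∧
      (c 0 ≠ 0 ∨ k 5 ≠ 0) := by
  have hP := two_le_prime p
  obtain ⟨E, hE⟩ := exists_det_eq_zero (P := p) (by
    rcases hp.out.two_le.eq_or_lt with h | h
    · left; exact_mod_cast h.symm
    · right; exact_mod_cast h)
  obtain ⟨x, y, hxy, h1, h2⟩ := exists_ne_zero_of_det_eq_zero hE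
  have h := isCoeff_extend ((isInnerRec_innerSol (E := E) hP).const_mul x)
    ((isOuterRec_outerSol (E := E) hP).const_mul y)
  have hc0 : extendInner (fun m => x * innerSol p E m) 0 = x := by
    have := extendInner_even (fun m => x * innerSol p E m) 0
    simpa [innerSol] using this
  have hk5 : extendOuter p (fun m => y * outerSol p E m) 5 = y := by
    have := extendOuter_odd p (fun m => y * outerSol p E m) 0
    simpa [outerSol] using this
  have hk : ∀ m, extendOuter p (fun m => y * outerSol p E m) (2 * m + 5) *
      ((p : ℝ)⁻¹) ^ (2 * m) = y * outerSol p E m := by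
    intro m
    have hp0 : (p : ℝ) ≠ 0 := by positivity
    rw [extendOuter_odd, inv_pow, mul_inv_cancel_right₀ (by positivity)]
  refine ⟨E, _, _, h, h.energyCondition_iff.2 ?_, by rw [hc0, hk5]; exact hxy⟩
  simp only [hk, hc0, hk5, extendInner_even, mul_assoc, tsum_mul_left]
  rw [entryA, entryB] at h1
  rw [entryC, entryD] at h2
  constructor <;> linarith

end Main

end PAdicSchrodinger

/-- Take `B = 1`. For `p` large relative to `E` the series converge at every point; an `E` with
non-zero `(c_0, k_5)` exists; and for every `E`, `c`, `k` subject to the recursions and the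
energy conditions the series converge everywhere and `ψ_0` solves the equation. -/
theorem theorem18 (p : ℕ) [Fact p.Prime] :
    (∀ (E : ℝ) (c k : ℕ → ℝ), |E| + 1 < (p : ℝ) ^ 2 →
      PAdicSchrodinger.IsCoeff p 1 E c k → PAdicSchrodinger.ConvergesEverywhere p c k) ∧
    (∃ (E : ℝ) (c k : ℕ → ℝ),
      PAdicSchrodinger.IsCoeff p 1 E c k ∧ PAdicSchrodinger.EnergyCondition p 1 E c k ∧
        (c 0 ≠ 0 ∨ k 5 ≠ 0)) ∧
    (∀ (E : ℝ) (c k : ℕ → ℝ),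
      PAdicSchrodinger.IsCoeff p 1 E c k → PAdicSchrodinger.EnergyCondition p 1 E c k →
        PAdicSchrodinger.ConvergesEverywhere p c k ∧
          PAdicSchrodinger.IsSolution p 1 E (PAdicSchrodinger.psi p c k)) := by
  have hP := PAdicSchrodinger.two_le_prime p
  refine ⟨fun E c k hE h => ?_, PAdicSchrodinger.exists_eigenvalue p, fun E c k h hE => ?_⟩
  -- The hypothesis `|E| + 1 < p²` is stronger than the threshold `|E| < p² + 1` needed for
  -- summability.
  · exact h.convergesEverywhere (h.isInnerRec.summable hP (by linarith))
      (h.isOuterRec.summable hP (by linarith))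
  · obtain ⟨hC, hb⟩ := h.summable_of_energyCondition hE
    exact ⟨h.convergesEverywhere hC hb, h.isSolution hC hb hE⟩
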